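/- Let $\Omega\subset\mathbb R^d$, $d\in\{2,3\}$, be a bounded polytopal domain (open, connected) with a conforming mesh $\mathcal E_h$ whose elements are either all simplices, or all convex quadrilaterals ($d=2$) / convex hexahedra with planar faces ($d=3$). Let $X_h$ be the space of functions $v$ on $\Omega$, with no continuity across elements, whose restriction to each element $K$ is a polynomial of total degree at most one (simplices), respectively of degree at most one in each of the Cartesian variables (quadrilaterals, hexahedra). Let $h_K,h_e$ be the diameters of elements and faces, and $\Gamma_h$ the set of interior faces; for $e=\partial K_1\cap\partial K_2\in\Gamma_h$ let $\boldsymbol n_e$ be a fixed unit normal pointing from $K_1$ into $K_2$, $[v]=v|_{K_1}-v|_{K_2}$, and, for a positive scalar $A$ and a vector field $G$ that may both jump across $e$, with $A_i=A|_{K_i}$, $G_i=G|_{K_i}$, $$\{A\,G\cdot\boldsymbol n_e\}=\frac{A_2}{A_1+A_2}A_1G_1\cdot\boldsymbol n_e+\frac{A_1}{A_1+A_2}A_2G_2\cdot\boldsymbol n_e .$$ The set of boundary faces is the union of a nonempty set $\Gamma_{\rm D}$ and a set $\Gamma_{\rm N}$. Fix a time step, and let $P_h^n,S_{v_h}^n,S_{a_h}^n\in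 X_h$ be given. Let the mobilities $\lambda_\ell,\lambda_v,\lambda_a$ be positive continuous functions of $(p_\ell,s_v,s_a)\in\mathbb R^3$, $\rho_\ell,\rho_v,\rho_a>0$ the densities, $\lambda_t=\lambda_\ell+\lambda_v+\lambda_a$, $(\rho\lambda)_t=\rho_\ell\lambda_\ell+\rho_v\lambda_v+\rho_a\lambda_a$, with $0<\underline C_{\lambda_t}\le\lambda_t\le\overline C_{\lambda_t}$; let the permeability $\kappa$ be constant on each element, $0<\kappa_*\le\kappa\le\kappa^*$; let $p_{c,v}(s_v)$, $p_{c,a}(s_a)$ be $C^1$ functions on $\mathbb R$, $\boldsymbol g\in\mathbb R^d$, $q_t=q_\ell+q_v+q_a$ with $q_j\in L^\infty(\Omega)$ the sources at the new time, $j^{\rm N}_p$ integrable on the faces in $\Gamma_{\rm N}$, and $p_\ell^{\rm bdy}$ the trace on $\Gamma_{\rm D}$ of a function of $X_h$. A superscript $n$ means evaluation at $(P_h^n,S_{v_h}^n,S_{a_h}^n)$. Let $\theta\in\{-1,0,1\}$, let $\alpha_e\ge\alpha_*$ for $e\in\Gamma_h$, and let $\eta_e^n=2x_1x_2/(x_1+x_2)$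 with $x_i=(\kappa\lambda_t^n)|_{K_i}$. Define $$b_p^n(v,w)=\sum_K\int_K\lambda_t^n\kappa\nabla v\cdot\nabla w+\sum_{e\in\Gamma_h}\frac{\alpha_e}{h_e}\int_e\eta_e^n[v][w]-\sum_{e\in\Gamma_h}\int_e\{\lambda_t^n\kappa\nabla v\cdot\boldsymbol n_e\}[w]+\theta\sum_{e\in\Gamma_h}\int_e\{\lambda_t^n\kappa\nabla w\cdot\boldsymbol n_e\}[v],$$ $$\begin{aligned}f_p^n(w)=&\int_\Omega q_tw+\sum_{e\in\Gamma_{\rm N}}\int_ej_p^{\rm N}w-\sum_K\int_K\bigl(\lambda_v^n\kappa\nabla p_{c,v}^n-\lambda_a^n\kappa\nabla p_{c,a}^n-\kappa(\rho\lambda)_t^n\boldsymbol g\bigr)\cdot\nabla w\\&+\sum_{e\in\Gamma_h}\int_e\bigl(\{\lambda_v^n\kappa\nabla p_{c,v}^n\cdot\boldsymbol n_e\}-\{\lambda_a^n\kappa\nabla p_{c,a}^n\cdot\boldsymbol n_e\}-\{\kappa(\rho\lambda)_t^n\boldsymbol g\cdot\boldsymbol n_e\}\bigr)[w].\end{aligned}$$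 There are constants $C_{\rm tr}>0$ such that $\|w\|_{L^2(e)}\le C_{\rm tr}h_K^{-1/2}\|w\|_{L^2(K)}$ for all $w\in X_h$, all elements $K$ and all faces $e\subset\partial K$. Moreover, for every such constant, if $$\alpha_*>\frac{\gamma}{4}\,(1-\theta)^2\,(\overline C_{\lambda_t}\kappa^*)^3(\underline C_{\lambda_t}\kappa_*)^{-3}\,C_{\rm tr}^2,$$ where $\gamma=1$ for meshes of simplices, of quadrilaterals, or of rectangular boxes, and $\gamma=3$ for other hexahedral meshes, then there is exactly one $P_h^{n+1}\in X_h$ with $P_h^{n+1}=p_\ell^{\rm bdy}$ on $\Gamma_{\rm D}$ and $b_p^n(P_h^{n+1},w)=f_p^n(w)$ for all $w\in X_h$ that vanish on $\Gamma_{\rm D}$. -/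

import Mathlib

open MeasureTheory Set

/-- Euclidean space `ℝ^d`. -/
abbrev E (d : ℕ) : Type := EuclideanSpace ℝ (Fin d)

noncomputable section

/-! ### Elements, faces and meshes -/

/-- `F` is a face of codimension one of the convex polytope `K ⊆ ℝ^d`
(an edge for `d = 2`, a two-dimensional face for `d = 3`). -/
def IsFacet {d : ℕ} (K F : Set (E d)) : Prop :=
  F.Nonempty ∧ IsExposed ℝ K F ∧ Module.finrank ℝ (vectorSpan ℝ F) + 1 = d

/-- `K` is a nondegenerate closed simplex in `ℝ^d`. -/
def IsSimplexCell {d : ℕ} (K : Set (E d)) : Prop :=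
  ∃ v : Fin (d + 1) → E d, AffineIndependent ℝ v ∧ K = convexHull ℝ (range v)

/-- `K` is a (closed, nondegenerate, convex) quadrilateral if `d = 2`, and a hexahedron with planar
faces if `d = 3`: its `2 ^ d` vertices are labelled by the vertices of the cube, in such a way that
its facets are exactly the sets spanned by the facets of the cube. -/
def IsCubeCell {d : ℕ} (K : Set (E d)) : Prop :=
  ∃ v : (Fin d → Bool) → E d,
    Function.Injective v ∧ K = convexHull ℝ (range v) ∧ (interior K).Nonempty ∧
    extremePoints ℝ K = range v ∧
    ∀ F : Set (E d), IsFacet K F ↔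
      ∃ (i : Fin d) (b : Bool), F = convexHull ℝ (v '' {s | s i = b})

/-- `K` is a rectangle (`d = 2`), a rectangular box (`d = 3`), in an arbitrary position. -/
def IsBox {d : ℕ} (K : Set (E d)) : Prop :=
  ∃ (u : OrthonormalBasis (Fin d) ℝ (E d)) (c : E d) (l : Fin d → ℝ),
    (∀ i, 0 < l i) ∧ K = {x | ∀ i, inner ℝ (u i) (x - c) ∈ Icc 0 (l i)}

/-- The two types of meshes. -/
inductive CellType
  | simplex
  | cube

/-- `K` is an element of the given type. -/
def IsCell {d : ℕ} : CellType → Set (E d) → Prop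
  | .simplex, K => IsSimplexCell K
  | .cube, K => IsCubeCell K

/-- A conforming mesh, with elements indexed by `ι`, of a bounded polytopal domain of `ℝ^d`,
together with a fixed orientation of its interior faces. -/
structure DGMesh (d : ℕ) (ι : Type*) [Fintype ι] where
  /-- all elements are simplices, or all are quadrilaterals / hexahedra -/
  cell : CellType
  /-- the (closed) elements -/
  elem : ι → Set (E d)
  isCell : ∀ K, IsCell cell (elem K)
  elem_injective : Function.Injective elem
  /-- conformity: two elements meet in a (possibly empty) common face of any dimension -/
  conforming : ∀ K K', K ≠ K' →
    IsExposed ℝ (elem K) (elem K ∩ elem K') ∧ IsExposed ℝ (elem K') (elem K ∩ elem K')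
  /-- the interior faces `e = ∂K₁ ∩ ∂K₂`, represented by the pairs `(K₁, K₂)` -/
  faces : Finset (ι × ι)
  faces_facet : ∀ e ∈ faces, e.1 ≠ e.2 ∧ IsFacet (elem e.1) (elem e.1 ∩ elem e.2)
  faces_xor : ∀ K K', K ≠ K' → IsFacet (elem K) (elem K ∩ elem K') →
    Xor ((K, K') ∈ faces) ((K', K) ∈ faces)
  /-- the unit normal `n_e` of the interior face `e = (K₁, K₂)`, pointing from `K₁` into `K₂` -/
  normal : ι × ι → E d
  normal_norm : ∀ e ∈ faces, ‖normal e‖ = 1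
  normal_fst : ∀ e ∈ faces, ∀ x ∈ elem e.1 ∩ elem e.2, ∀ y ∈ elem e.1,
    inner ℝ (normal e) (y - x) ≤ 0
  normal_snd : ∀ e ∈ faces, ∀ x ∈ elem e.1 ∩ elem e.2, ∀ y ∈ elem e.2,
    0 ≤ inner ℝ (normal e) (y - x)

namespace DGMesh

variable {d : ℕ} {ι : Type*} [Fintype ι]

/-- The open set `Ω` that is discretized by the mesh. -/
def domain (M : DGMesh d ι) : Set (E d) := interior (⋃ K, M.elem K)

/-- The interior face as a subset of `ℝ^d`. -/
def face (M : DGMesh d ι) (e : ι × ι) : Set (E d) := M.elem e.1 ∩ M.elem e.2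

/-- The size `h_e` of an interior face. -/
def faceSize (M : DGMesh d ι) (e : ι × ι) : ℝ := Metric.diam (M.face e)

/-- The boundary faces: pairs `(K, F)`, where `F` is a facet of the element `K` which is not shared
with another element. -/
def bdryFaces (M : DGMesh d ι) : Set (ι × Set (E d)) :=
  {p | IsFacet (M.elem p.1) p.2 ∧ ∀ K', K' ≠ p.1 → p.2 ≠ M.elem p.1 ∩ M.elem K'}

end DGMesh

/-! ### The discontinuous finite element space -/

/-- The monomial `∏_{i ∈ S} x_i`. -/
def multiMonomial {d : ℕ} (S : Finset (Fin d)) : E d → ℝ := fun x => ∏ i ∈ S, x i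

/-- The local spaces, in the coordinates of `ℝ^d`: polynomials of total degree at most one on
simplices, and `ℚ₁`, the polynomials of degree at most one in each variable, otherwise. -/
def localSpace (d : ℕ) : CellType → Submodule ℝ (E d → ℝ)
  | .simplex => Submodule.span ℝ (multiMonomial '' {S : Finset (Fin d) | S.card ≤ 1})
  | .cube => Submodule.span ℝ (range (multiMonomial (d := d)))

namespace DGMesh

variable {d : ℕ} {ι : Type*} [Fintype ι]

/-- The space `X_h`: a discontinuous piecewise polynomial function `v` is given by the polynomials
`v K` with `v = v K` on the element `K`. -/
def X (M : DGMesh d ι) : Submodule ℝ (ι → E d → ℝ) :=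
  Submodule.pi univ fun _ => localSpace d M.cell

/-- The jump `[v] = v|_{K₁} - v|_{K₂}` on the interior face `e = (K₁, K₂)`. -/
def jump (_M : DGMesh d ι) (v : ι → E d → ℝ) (e : ι × ι) (x : E d) : ℝ := v e.1 x - v e.2 x

/-- The trace of `v` equals `f` almost everywhere on the boundary faces in `Γ`. -/
def TraceEq (_M : DGMesh d ι) (Γ : Finset (ι × Set (E d))) (v : ι → E d → ℝ) (f : E d → ℝ) : Prop :=
  ∀ p ∈ Γ, v p.1 =ᵐ[μHE[d - 1].restrict p.2] f

/-- `C` is a constant in the discrete trace inequality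
`‖w‖_{L²(e)} ≤ C h_K^{-1/2} ‖w‖_{L²(K)}` for `w ∈ X_h` and all faces `e` of elements `K`. -/
def IsTraceConstant (M : DGMesh d ι) (C : ℝ) : Prop :=
  ∀ w ∈ M.X, ∀ (K : ι) (F : Set (E d)), IsFacet (M.elem K) F →
    √(∫ x in F, w K x ^ 2 ∂μHE[d - 1]) ≤
      C * (√(Metric.diam (M.elem K)))⁻¹ * √(∫ x in M.elem K, w K x ^ 2)

open Classical in
/-- The factor `γ` in the penalty threshold: `1` on simplices, on quadrilaterals, and on rectangular
boxes; `3` on general hexahedra. -/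
def shapeFactor (M : DGMesh d ι) : ℝ :=
  if M.cell = CellType.simplex ∨ d = 2 ∨ ∀ K, IsBox (M.elem K) then 1 else 3

end DGMesh

/-! ### Data of the discrete pressure problem -/

/-- Harmonic average. -/
def harmonicAvg (x₁ x₂ : ℝ) : ℝ := 2 * x₁ * x₂ / (x₁ + x₂)

/-- The weighted average `ω₁ A₁ z₁ + ω₂ A₂ z₂`, `ω₁ = A₂ / (A₁ + A₂)`, `ω₂ = A₁ / (A₁ + A₂)`. -/
def weightedAvg (A₁ A₂ z₁ z₂ : ℝ) : ℝ :=
  A₂ / (A₁ + A₂) * (A₁ * z₁) + A₁ / (A₁ + A₂) * (A₂ * z₂)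

/-- The data of one time step of the discrete liquid pressure equation. -/
structure PressureData (d : ℕ) (ι : Type*) where
  /-- absolute permeability, constant on each element -/
  κ : ι → ℝ
  /-- mobilities of the three phases, as functions of `p_ℓ`, `s_v`, `s_a` -/
  lamL : ℝ → ℝ → ℝ → ℝ
  lamV : ℝ → ℝ → ℝ → ℝ
  lamA : ℝ → ℝ → ℝ → ℝ
  /-- phase densities -/
  rhoL : ℝ
  rhoV : ℝ
  rhoA : ℝ
  /-- capillary pressures, as functions of `s_v` and of `s_a` -/
  pcv : ℝ → ℝ
  pca : ℝ → ℝ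
  /-- gravity -/
  grav : E d
  /-- source terms at the new time -/
  qL : E d → ℝ
  qV : E d → ℝ
  qA : E d → ℝ
  /-- Dirichlet and Neumann data -/
  pbdy : E d → ℝ
  jN : E d → ℝ
  /-- symmetrization parameter -/
  θ : ℝ
  /-- penalty parameters on the interior faces -/
  α : ι × ι → ℝ
  /-- discrete liquid pressure, vapor saturation, aqueous saturation at the old time -/
  P : ι → E d → ℝ
  Sv : ι → E d → ℝ
  Sa : ι → E d → ℝ

namespace PressureData

variable {d : ℕ} {ι : Type*} [Fintype ι]

/-- Total mobility `λ_t`. -/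
def lamT (D : PressureData d ι) (p sv sa : ℝ) : ℝ :=
  D.lamL p sv sa + D.lamV p sv sa + D.lamA p sv sa

/-- `(ρλ)_t`. -/
def rhoLamT (D : PressureData d ι) (p sv sa : ℝ) : ℝ :=
  D.rhoL * D.lamL p sv sa + D.rhoV * D.lamV p sv sa + D.rhoA * D.lamA p sv sa

/-- `κ f(P_h^n, S_{v_h}^n, S_{a_h}^n)` on the element `K`, for `f` one of
`λ_t`, `λ_v`, `λ_a`, `(ρλ)_t`. -/
def coef (D : PressureData d ι) (f : ℝ → ℝ → ℝ → ℝ) (K : ι) (x : E d) : ℝ :=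
  D.κ K * f (D.P K x) (D.Sv K x) (D.Sa K x)

/-- `{κ f(P_h^n, S_{v_h}^n, S_{a_h}^n) G · n_e}` on the interior face `e`, for a piecewise defined
vector field `G`. -/
def fluxAvg (D : PressureData d ι) (M : DGMesh d ι) (f : ℝ → ℝ → ℝ → ℝ) (G : ι → E d → E d)
    (e : ι × ι) (x : E d) : ℝ :=
  weightedAvg (D.coef f e.1 x) (D.coef f e.2 x)
    (inner ℝ (G e.1 x) (M.normal e)) (inner ℝ (G e.2 x) (M.normal e))

/-- Broken gradient. -/
def brokenGrad (v : ι → E d → ℝ) (K : ι) (x : E d) : E d := gradient (v K) x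

/-- Broken gradient of `p_{c,v}(S_{v_h}^n)`. -/
def gradPcv (D : PressureData d ι) : ι → E d → E d := brokenGrad fun K x => D.pcv (D.Sv K x)

/-- Broken gradient of `p_{c,a}(S_{a_h}^n)`. -/
def gradPca (D : PressureData d ι) : ι → E d → E d := brokenGrad fun K x => D.pca (D.Sa K x)

/-- The bilinear form `b_p^n`. -/
def b (D : PressureData d ι) (M : DGMesh d ι) (v w : ι → E d → ℝ) : ℝ :=
  (∑ K, ∫ x in M.elem K, D.coef D.lamT K x * inner ℝ (brokenGrad v K x) (brokenGrad w K x))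
  + (∑ e ∈ M.faces, D.α e * (M.faceSize e)⁻¹ *
      ∫ x in M.face e, harmonicAvg (D.coef D.lamT e.1 x) (D.coef D.lamT e.2 x) *
        M.jump v e x * M.jump w e x ∂μHE[d - 1])
  - (∑ e ∈ M.faces, ∫ x in M.face e,
      D.fluxAvg M D.lamT (brokenGrad v) e x * M.jump w e x ∂μHE[d - 1])
  + D.θ * (∑ e ∈ M.faces, ∫ x in M.face e,
      D.fluxAvg M D.lamT (brokenGrad w) e x * M.jump v e x ∂μHE[d - 1])

/-- The linear form `f_p^n`, with Neumann faces `ΓN`. -/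
def f (D : PressureData d ι) (M : DGMesh d ι) (ΓN : Finset (ι × Set (E d)))
    (w : ι → E d → ℝ) : ℝ :=
  (∑ K, ∫ x in M.elem K, (D.qL x + D.qV x + D.qA x) * w K x)
  + (∑ p ∈ ΓN, ∫ x in p.2, D.jN x * w p.1 x ∂μHE[d - 1])
  - (∑ K, ∫ x in M.elem K,
      inner ℝ (D.coef D.lamV K x • D.gradPcv K x - D.coef D.lamA K x • D.gradPca K x
        - D.coef D.rhoLamT K x • D.grav) (brokenGrad w K x))
  + (∑ e ∈ M.faces, ∫ x in M.face e,
      D.fluxAvg M D.lamV D.gradPcv e x * M.jump w e x ∂μHE[d - 1])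
  - (∑ e ∈ M.faces, ∫ x in M.face e,
      D.fluxAvg M D.lamA D.gradPca e x * M.jump w e x ∂μHE[d - 1])
  - (∑ e ∈ M.faces, ∫ x in M.face e,
      D.fluxAvg M D.rhoLamT (fun _ _ => D.grav) e x * M.jump w e x ∂μHE[d - 1])

/-- `u` solves the discrete liquid pressure problem with Dirichlet faces `ΓD` and Neumann
faces `ΓN`. -/
def IsDiscreteSolution (D : PressureData d ι) (M : DGMesh d ι) (ΓD ΓN : Finset (ι × Set (E d)))
    (u : ι → E d → ℝ) : Prop :=
  u ∈ M.X ∧ M.TraceEq ΓD u D.pbdy ∧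
    ∀ w ∈ M.X, M.TraceEq ΓD w 0 → D.b M u w = D.f M ΓN w

end PressureData

end

/-!
The discrete problem is a square linear system on the finite-dimensional space of piecewise
polynomials that vanish on the Dirichlet faces, so it suffices that the energy `b w w` vanishes
only for `w = 0` on that space (`existsUnique_of_definite`).

*Coercivity.* The weighted average of the fluxes equals `η (z₁ + z₂) / 2`, where `η` is the
harmonic average of the coefficients and `z₁`, `z₂` are the two normal derivatives. By Young's
inequality the penalty on the jumps absorbs the consistency terms at the price of
`∑ h_e ∫_e (z₁² + z₂²)` (`PressureData.integral_face_terms_ge`). These sums are collected element by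
element: for each element `K` one needs `∑_{e ⊆ ∂K} h_e ∫_e (∇w · n_e)² ≤ 2 γ C_tr² ∫_K |∇w|²`
(`DGMesh.sum_integral_facets_le`). Applying the trace inequality and counting facets is not
enough to get the stated `γ`:
* On a simplex `∇w` is constant, so only the measures of the facets matter. The trace inequality
  for the affine function that is `1` on a facet and `-1` at the opposite vertex bounds the
  measure of the facet with an additional factor `2 / (d + 1)`, which compensates for the number
  `d + 1` of facets (`integral_sq_affine_simplex_le`, `sum_integral_facets_simplex_le`).
* On a box the normals are the vectors `± u_i` of an orthonormal frame, hence
  `∑ (g · n_e)² ≤ 2 |g|²` (`sum_inner_normal_sq_box_le`).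
* On a quadrilateral `h_e |g · n_e|` is the variation along the edge `e` of a linear functional
  of norm `|g|`, and by convexity the variation along the whole boundary is at most twice the
  oscillation, so at most `2 |g| h_K` (`sum_diam_mul_inner_sq_quadrilateral_le`).
* A general hexahedron has six facets, which gives `γ = 3`.

The collection by elements uses that different interior faces of an element are different facets
(`DGMesh.injOn_face`): by conformity two elements cannot lie on the same side of a common facet.

*Definiteness.* If `b w w = 0`, then `w` is constant on each element, without jumps on the
interior faces and zero on some Dirichlet face. Since the domain is connected and sets of
codimension two do not disconnect it, any two elements are linked through interior faces, and
`w = 0` (`DGMesh.forall_of_forall_faces_iff`).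

The trace constant exists because on the finite-dimensional local space all `L²` seminorms are
dominated by the `L²` norm of the element (`exists_sqrt_integral_sq_le`), and an element has
finitely many facets.
-/

/-! ### Facets of convex bodies -/

/-- A convex set contains a relative ball of its affine span. -/
theorem exists_relative_ball_subset {d : ℕ} {F : Set (E d)} (hF : Convex ℝ F) (hne : F.Nonempty) :
    ∃ x ∈ F, ∃ ε > 0, ∀ v ∈ vectorSpan ℝ F, ‖v‖ < ε → x + v ∈ F := by
  obtain ⟨x, hx⟩ := hne.intrinsicInterior hF
  obtain ⟨y, hy, rfl⟩ := mem_intrinsicInterior.1 hx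
  rw [mem_interior_iff_mem_nhds, Metric.mem_nhds_iff] at hy
  obtain ⟨ε, hε, hb⟩ := hy
  refine ⟨y, hb (Metric.mem_ball_self hε), ε, hε, fun v hv hvε => ?_⟩
  have hmem : (y : E d) + v ∈ affineSpan ℝ F := by
    rw [add_comm]
    exact AffineSubspace.vadd_mem_of_mem_direction (by rwa [direction_affineSpan]) y.2
  have : (⟨y + v, hmem⟩ : affineSpan ℝ F) ∈ Metric.ball y ε := by
    rw [Metric.mem_ball, Subtype.dist_eq, dist_eq_norm]
    simpa using hvε
  exact hb this

/-- On the affine span of `F` the Euclidean Hausdorff measure is the Haar measure of the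
direction. -/
theorem euclideanHausdorffMeasure_eq_preimage {d : ℕ} {F : Set (E d)}
    (hdim : Module.finrank ℝ (vectorSpan ℝ F) + 1 = d) {x : E d} (hx : x ∈ F) :
    (μHE[d - 1] : Measure (E d)) F =
      (μHE[Module.finrank ℝ (vectorSpan ℝ F)] : Measure (vectorSpan ℝ F))
        ((fun v : vectorSpan ℝ F => (v : E d) + x) ⁻¹' F) := by
  have hiso : Isometry (fun v : vectorSpan ℝ F => (v : E d) + x) :=
    (IsometryEquiv.addRight x).isometry.comp isometry_subtype_coe
  have hd : d - 1 = Module.finrank ℝ (vectorSpan ℝ F) := by omega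
  rw [hd, hiso.euclideanHausdorffMeasure_preimage, inter_eq_left.2]
  intro y hy
  exact ⟨⟨y - x, vsub_mem_vectorSpan ℝ hy hx⟩, by simp⟩

theorem euclideanHausdorffMeasure_lt_top {d : ℕ} {F : Set (E d)} (hc : IsCompact F)
    (hne : F.Nonempty) (hdim : Module.finrank ℝ (vectorSpan ℝ F) + 1 = d) :
    (μHE[d - 1] : Measure (E d)) F < ⊤ := by
  obtain ⟨x, hx⟩ := hne
  rw [euclideanHausdorffMeasure_eq_preimage hdim hx]
  have hiso : Isometry (fun v : vectorSpan ℝ F => (v : E d) + x) :=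
    (IsometryEquiv.addRight x).isometry.comp isometry_subtype_coe
  have hemb : Topology.IsClosedEmbedding (fun v : vectorSpan ℝ F => (v : E d) + x) :=
    hiso.isClosedEmbedding
  exact (hemb.isCompact_preimage hc).measure_lt_top

theorem euclideanHausdorffMeasure_pos {d : ℕ} {F : Set (E d)} (hF : Convex ℝ F)
    (hne : F.Nonempty) (hdim : Module.finrank ℝ (vectorSpan ℝ F) + 1 = d) :
    0 < (μHE[d - 1] : Measure (E d)) F := by
  obtain ⟨x, hx, ε, hε, hball⟩ := exists_relative_ball_subset hF hne
  rw [euclideanHausdorffMeasure_eq_preimage hdim hx]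
  refine (Metric.measure_ball_pos _ (0 : vectorSpan ℝ F) hε).trans_le (measure_mono ?_)
  intro v hv
  rw [mem_ball_zero_iff] at hv
  simp only [mem_preimage]
  rw [add_comm]
  exact hball v v.2 hv

theorem IsFacet.subset {d : ℕ} {K F : Set (E d)} (h : IsFacet K F) : F ⊆ K := h.2.1.subset

theorem IsFacet.isCompact {d : ℕ} {K F : Set (E d)} (h : IsFacet K F) (hK : IsCompact K) :
    IsCompact F := h.2.1.isCompact hK

theorem IsFacet.convex {d : ℕ} {K F : Set (E d)} (h : IsFacet K F) (hK : Convex ℝ K) :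
    Convex ℝ F := h.2.1.convex hK

theorem mem_orthogonal_vectorSpan {d : ℕ} {F : Set (E d)} {n : E d}
    (h : ∀ x ∈ F, ∀ y ∈ F, inner ℝ n (y - x) ≤ 0) : n ∈ (vectorSpan ℝ F)ᗮ := by
  rw [Submodule.mem_orthogonal']
  intro u hu
  induction hu using Submodule.span_induction with
  | mem u hu =>
    obtain ⟨a, ha, b, hb, rfl⟩ := Set.mem_vsub.1 hu
    have h1 := h b hb a ha
    have h2 := h a ha b hb
    rw [vsub_eq_sub]
    have : inner ℝ n (b - a) = - inner ℝ n (a - b) := by rw [← inner_neg_right, neg_sub]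
    linarith
  | zero => simp
  | add u v _ _ hu hv => rw [inner_add_right, hu, hv, add_zero]
  | smul c u _ hu => rw [inner_smul_right, hu, mul_zero]

/-- A nonempty exposed face is the set of maximizers of an inner product functional. -/
theorem IsExposed.exists_inner {d : ℕ} {K F : Set (E d)} (h : IsExposed ℝ K F)
    (hne : F.Nonempty) :
    ∃ a ∈ (vectorSpan ℝ F)ᗮ, F = {x ∈ K | ∀ y ∈ K, inner ℝ a y ≤ inner ℝ a x} := by
  obtain ⟨l, hl⟩ := h hne
  have hla : ∀ y, l y = inner ℝ ((InnerProductSpace.toDual ℝ (E d)).symm l) y := fun y => by simp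
  refine ⟨(InnerProductSpace.toDual ℝ (E d)).symm l, mem_orthogonal_vectorSpan ?_, ?_⟩
  · intro x hx y hy
    rw [hl] at hx hy
    rw [inner_sub_right, ← hla, ← hla]
    linarith [hx.2 y hy.1]
  · simpa only [hla] using hl

theorem exists_smul_eq_of_mem_orthogonal {d : ℕ} {V : Submodule ℝ (E d)}
    (hV : Module.finrank ℝ V + 1 = d) {n a : E d} (hn : n ∈ Vᗮ) (hn0 : n ≠ 0) (ha : a ∈ Vᗮ) :
    ∃ c : ℝ, a = c • n := by
  have h1 : Module.finrank ℝ Vᗮ = 1 := by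
    have := V.finrank_add_finrank_orthogonal
    rw [finrank_euclideanSpace_fin] at this
    omega
  obtain ⟨c, hc⟩ := (finrank_eq_one_iff_of_nonzero' (⟨n, hn⟩ : Vᗮ)
    (by simpa using hn0)).1 h1 ⟨a, ha⟩
  exact ⟨c, by simpa using (congrArg Subtype.val hc).symm⟩

/-- `n` is an outward unit normal to the convex body `K` along `F`. -/
def IsOutwardNormal {d : ℕ} (K F : Set (E d)) (n : E d) : Prop :=
  ‖n‖ = 1 ∧ ∀ x ∈ F, ∀ y ∈ K, inner ℝ n (y - x) ≤ 0

theorem IsOutwardNormal.mem_orthogonal {d : ℕ} {K F : Set (E d)} {n : E d}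
    (hn : IsOutwardNormal K F n) (hF : F ⊆ K) : n ∈ (vectorSpan ℝ F)ᗮ :=
  mem_orthogonal_vectorSpan fun x hx y hy => hn.2 x hx y (hF hy)

theorem IsOutwardNormal.ne_zero {d : ℕ} {K F : Set (E d)} {n : E d}
    (hn : IsOutwardNormal K F n) : n ≠ 0 := by
  rintro rfl
  simpa using hn.1

/-- A facet is determined by its outward normal. -/
theorem IsFacet.eq_setOf_inner_le {d : ℕ} {K F : Set (E d)} (hF : IsFacet K F) {n : E d}
    (hn : IsOutwardNormal K F n) : F = {x ∈ K | ∀ y ∈ K, inner ℝ n y ≤ inner ℝ n x} := by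
  obtain ⟨hne, hexp, hdim⟩ := hF
  obtain ⟨a, ha, hFa⟩ := hexp.exists_inner hne
  obtain ⟨c, rfl⟩ := exists_smul_eq_of_mem_orthogonal hdim
    (hn.mem_orthogonal hexp.subset) hn.ne_zero ha
  apply Subset.antisymm
  · intro x hx
    refine ⟨hexp.subset hx, fun y hy => ?_⟩
    have := hn.2 x hx y hy
    rw [inner_sub_right] at this
    linarith
  · rintro z ⟨hz, hzmax⟩
    obtain ⟨x, hx⟩ := hne
    have h1 := hn.2 x hx z hz
    rw [inner_sub_right] at h1
    have h2 := hzmax x (hexp.subset hx)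
    have h3 : inner ℝ n z = inner ℝ n x := by linarith
    rw [hFa] at hx ⊢
    refine ⟨hz, fun y hy => ?_⟩
    have := hx.2 y hy
    simp only [inner_smul_left] at this ⊢
    rw [h3]
    exact this

/-- A linear functional that is constant on a set with interior points vanishes. -/
theorem eq_zero_of_forall_inner_sub_eq_zero {d : ℕ} {K : Set (E d)} (hK : (interior K).Nonempty)
    {n : E d} {x : E d} (h : ∀ y ∈ K, inner ℝ n (y - x) = 0) : n = 0 := by
  obtain ⟨z, hz⟩ := hK
  rw [mem_interior_iff_mem_nhds, Metric.mem_nhds_iff] at hz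
  obtain ⟨ε, hε, hb⟩ := hz
  by_contra hn
  have hnn : 0 < ‖n‖ := norm_pos_iff.2 hn
  have h1 := h z (hb (Metric.mem_ball_self hε))
  have h2 := h (z + (ε / 2 / ‖n‖) • n) (hb (by
    rw [Metric.mem_ball, dist_eq_norm, add_sub_cancel_left, norm_smul, Real.norm_eq_abs,
      abs_of_pos (by positivity), div_mul_cancel₀ _ hnn.ne']
    linarith))
  rw [add_sub_right_comm, inner_add_right, h1, zero_add, inner_smul_right,
    real_inner_self_eq_norm_sq] at h2
  have : 0 < ε / 2 / ‖n‖ * ‖n‖ ^ 2 := by positivity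
  linarith

theorem IsOutwardNormal.unique {d : ℕ} {K F : Set (E d)} (hF : IsFacet K F)
    (hK : (interior K).Nonempty) {n n' : E d} (hn : IsOutwardNormal K F n)
    (hn' : IsOutwardNormal K F n') : n' = n := by
  obtain ⟨c, hc⟩ := exists_smul_eq_of_mem_orthogonal hF.2.2
    (hn.mem_orthogonal hF.subset) hn.ne_zero (hn'.mem_orthogonal hF.subset)
  have h1 : |c| = 1 := by
    have := hn'.1
    rwa [hc, norm_smul, hn.1, mul_one, Real.norm_eq_abs] at this
  rcases (abs_eq zero_le_one).1 h1 with rfl | rfl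
  · simpa using hc
  · exfalso
    obtain ⟨x, hx⟩ := hF.1
    apply hn.ne_zero
    refine eq_zero_of_forall_inner_sub_eq_zero hK (x := x) fun y hy => ?_
    have h2 := hn.2 x hx y hy
    have h3 := hn'.2 x hx y hy
    rw [hc, neg_one_smul, inner_neg_left] at h3
    linarith

/-- An exposed face of full dimension is the whole set. -/
theorem IsExposed.eq_of_finrank_eq {d : ℕ} {K F : Set (E d)} (h : IsExposed ℝ K F)
    (hne : F.Nonempty) (hdim : Module.finrank ℝ (vectorSpan ℝ F) = d) : F = K := by
  obtain ⟨a, ha, hFa⟩ := h.exists_inner hne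
  have htop : vectorSpan ℝ F = ⊤ := by
    apply Submodule.eq_top_of_finrank_eq
    rw [hdim, finrank_euclideanSpace_fin]
  rw [htop, Submodule.top_orthogonal_eq_bot, Submodule.mem_bot] at ha
  rw [hFa, ha]
  simp

/-- Two convex bodies on the same side of a common facet overlap: if their intersection is an
exposed face of the first one, it is the first one. -/
theorem eq_inter_of_common_facet {d : ℕ} {K K' F : Set (E d)} (hK : Convex ℝ K)
    (hK' : Convex ℝ K') (hKi : (interior K).Nonempty) (hKi' : (interior K').Nonempty)
    (hF : F.Nonempty) (hFc : Convex ℝ F) (hdim : Module.finrank ℝ (vectorSpan ℝ F) + 1 = d)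
    (hFK : F ⊆ K) (hFK' : F ⊆ K') {n : E d} (hn : IsOutwardNormal K F n)
    (hn' : IsOutwardNormal K' F n) (hexp : IsExposed ℝ K (K ∩ K')) : K ∩ K' = K := by
  obtain ⟨x, hx, ε, hε, hball⟩ := exists_relative_ball_subset hFc hF
  have hno := hn.mem_orthogonal hFK
  obtain ⟨y, hy, hy1⟩ : ∃ y ∈ K, inner ℝ n (y - x) < 0 := by
    by_contra! hcon
    exact hn.ne_zero (eq_zero_of_forall_inner_sub_eq_zero hKi (x := x)
      fun y hy => le_antisymm (hn.2 x hx y hy) (hcon y hy))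
  obtain ⟨y', hy', hy1'⟩ : ∃ y ∈ K', inner ℝ n (y - x) < 0 := by
    by_contra! hcon
    exact hn.ne_zero (eq_zero_of_forall_inner_sub_eq_zero hKi' (x := x)
      fun y hy => le_antisymm (hn'.2 x hx y hy) (hcon y hy))
  have hne : (K ∩ K').Nonempty := ⟨x, hFK hx, hFK' hx⟩
  -- It suffices to find a point of `K ∩ K'` off the hyperplane of `F`.
  suffices h : ∃ z ∈ K ∩ K', inner ℝ n (z - x) < 0 by
    obtain ⟨z, hz, hzn⟩ := h
    obtain ⟨a, ha, hFa⟩ := hexp.exists_inner hne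
    obtain ⟨c, rfl⟩ := exists_smul_eq_of_mem_orthogonal hdim hno hn.ne_zero
      (Submodule.orthogonal_le (vectorSpan_mono ℝ (subset_inter hFK hFK')) ha)
    have hzx : inner ℝ (c • n) (z - x) = 0 :=
      (Submodule.mem_orthogonal' _ _).1 ha _ (vsub_mem_vectorSpan ℝ hz ⟨hFK hx, hFK' hx⟩)
    rw [inner_smul_left, mul_eq_zero] at hzx
    have hc : c = 0 := by simpa [hzn.ne] using hzx
    rw [hFa, hc]
    simp
  set p := inner ℝ n (y - x)
  set q := inner ℝ n (y' - x)
  -- The points `x + s (y - x)` and `x + s' (y' - x)` have the same height below the facet.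
  set r := p / q with hr
  have hr0 : 0 < r := div_pos_of_neg_of_neg hy1 hy1'
  set t := (y - x) - r • (y' - x) with ht
  have htV : t ∈ vectorSpan ℝ F := by
    have hoo : t ∈ (vectorSpan ℝ F)ᗮᗮ := by
      rw [Submodule.mem_orthogonal]
      intro u hu
      obtain ⟨c, rfl⟩ := exists_smul_eq_of_mem_orthogonal hdim hno hn.ne_zero hu
      rw [inner_smul_left, ht, inner_sub_right, inner_smul_right, hr]
      change _ * (p - p / q * q) = 0
      rw [div_mul_cancel₀ _ hy1'.ne]
      simp
    rwa [Submodule.orthogonal_orthogonal] at hoo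
  obtain ⟨s, hs0, hs1, hs2, hs3⟩ : ∃ s : ℝ, 0 < s ∧ s ≤ 1 ∧ s * r ≤ 1 / 2 ∧
      2 * s * ‖t‖ < ε := by
    refine ⟨min (min 1 (1 / (2 * r))) (ε / (4 * (‖t‖ + 1))), by positivity, ?_, ?_, ?_⟩
    · exact (min_le_left _ _).trans (min_le_left _ _)
    · calc _ ≤ 1 / (2 * r) * r := by
            gcongr
            exact (min_le_left _ _).trans (min_le_right _ _)
        _ = 1 / 2 := by field_simp
    · calc _ ≤ 2 * (ε / (4 * (‖t‖ + 1))) * ‖t‖ := by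
            gcongr
            exact min_le_right _ _
        _ = ε * (‖t‖ / (2 * (‖t‖ + 1))) := by field_simp; ring
        _ < ε * 1 := by
            gcongr
            rw [div_lt_one (by positivity)]
            linarith [norm_nonneg t]
        _ = ε := mul_one _
  refine ⟨x + s • (y - x), ⟨?_, ?_⟩, ?_⟩
  · exact hK.add_smul_sub_mem (hFK hx) hy ⟨hs0.le, hs1⟩
  · have h1 : 0 < 1 - s * r := by linarith
    have hw : x + (s / (1 - s * r)) • t ∈ F := by
      refine hball _ (Submodule.smul_mem _ _ htV) ?_
      rw [norm_smul, Real.norm_eq_abs, abs_of_pos (by positivity)]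
      refine lt_of_le_of_lt ?_ hs3
      gcongr
      rw [div_le_iff₀ h1]
      nlinarith
    have := hK' (hFK' hw) hy' h1.le (by positivity : 0 ≤ s * r) (by ring)
    convert this using 1
    rw [smul_add, smul_smul, mul_div_cancel₀ _ h1.ne', ht]
    module
  · rw [add_sub_cancel_left, inner_smul_right]
    exact mul_neg_of_pos_of_neg hs0 hy1

/-- An exposed face of a polytope is spanned by the vertices that it contains. -/
theorem IsExposed.eq_convexHull_image {d : ℕ} {κ : Type*} [Finite κ] {v : κ → E d} {F : Set (E d)}
    (h : IsExposed ℝ (convexHull ℝ (range v)) F) : F = convexHull ℝ (v '' {i | v i ∈ F}) := by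
  have hc : IsCompact (convexHull ℝ (range v)) := (finite_range v).isCompact_convexHull ℝ
  have hF := h.isCompact hc
  have hFc := h.convex (convex_convexHull ℝ _)
  apply Subset.antisymm
  · have hsub : F.extremePoints ℝ ⊆ v '' {i | v i ∈ F} := by
      intro x hx
      obtain ⟨i, rfl⟩ := extremePoints_convexHull_subset
        (h.isExtreme.extremePoints_subset_extremePoints hx)
      exact ⟨i, hx.1, rfl⟩
    have hcl : IsClosed (convexHull ℝ (v '' {i | v i ∈ F})) :=
      ((toFinite _).isCompact_convexHull ℝ).isClosed
    calc F = closure (convexHull ℝ (F.extremePoints ℝ)) :=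
          (closure_convexHull_extremePoints hF hFc).symm
      _ ⊆ _ := closure_minimal (convexHull_mono hsub) hcl
  · refine convexHull_min ?_ hFc
    rintro _ ⟨i, hi, rfl⟩
    exact hi

theorem finite_setOf_isFacet_convexHull {d : ℕ} {κ : Type*} [Finite κ] (v : κ → E d) :
    {F | IsFacet (convexHull ℝ (range v)) F}.Finite := by
  refine Set.Finite.of_finite_image (f := fun F => {i | v i ∈ F}) (toFinite _) ?_
  intro F hF G hG hFG
  rw [IsExposed.eq_convexHull_image hF.2.1, IsExposed.eq_convexHull_image hG.2.1]
  simp only at hFG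
  rw [hFG]

/-! ### Mesh elements -/

theorem IsSimplexCell.exists_affineBasis {d : ℕ} {K : Set (E d)} (h : IsSimplexCell K) :
    ∃ b : AffineBasis (Fin (d + 1)) ℝ (E d), K = convexHull ℝ (range b) := by
  obtain ⟨v, hv, rfl⟩ := h
  refine ⟨⟨v, hv, ?_⟩, rfl⟩
  rw [hv.affineSpan_eq_top_iff_card_eq_finrank_add_one]
  simp

theorem IsCell.exists_vertices {d : ℕ} {t : CellType} {K : Set (E d)} (h : IsCell t K) :
    (interior K).Nonempty ∧
      ∃ (κ : Type) (_ : Finite κ) (v : κ → E d), K = convexHull ℝ (range v) := by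
  cases t with
  | simplex =>
    obtain ⟨b, rfl⟩ := IsSimplexCell.exists_affineBasis h
    exact ⟨interior_convexHull_nonempty_iff_affineSpan_eq_top.2 b.tot, _, inferInstance, b, rfl⟩
  | cube =>
    obtain ⟨v, -, hK, hi, -⟩ := h
    exact ⟨hi, _, inferInstance, v, hK⟩

theorem IsCell.interior_nonempty {d : ℕ} {t : CellType} {K : Set (E d)} (h : IsCell t K) :
    (interior K).Nonempty := h.exists_vertices.1

theorem IsCell.isCompact {d : ℕ} {t : CellType} {K : Set (E d)} (h : IsCell t K) :
    IsCompact K := by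
  obtain ⟨-, κ, _, v, rfl⟩ := h.exists_vertices
  exact (finite_range v).isCompact_convexHull ℝ

theorem IsCell.convex {d : ℕ} {t : CellType} {K : Set (E d)} (h : IsCell t K) :
    Convex ℝ K := by
  obtain ⟨-, κ, _, v, rfl⟩ := h.exists_vertices
  exact convex_convexHull ℝ _

theorem IsCell.finite_setOf_isFacet {d : ℕ} {t : CellType} {K : Set (E d)} (h : IsCell t K) :
    {F | IsFacet K F}.Finite := by
  obtain ⟨-, κ, _, v, rfl⟩ := h.exists_vertices
  exact finite_setOf_isFacet_convexHull v

/-! ### Interior faces and connectivity of a mesh -/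

namespace DGMesh

variable {d : ℕ} {ι : Type*} [Fintype ι]

theorem isFacet_fst (M : DGMesh d ι) {e : ι × ι} (he : e ∈ M.faces) :
    IsFacet (M.elem e.1) (M.face e) := (M.faces_facet e he).2

theorem isFacet_snd (M : DGMesh d ι) {e : ι × ι} (he : e ∈ M.faces) :
    IsFacet (M.elem e.2) (M.face e) :=
  ⟨(M.isFacet_fst he).1, (M.conforming _ _ (M.faces_facet e he).1).2, (M.isFacet_fst he).2.2⟩

theorem isOutwardNormal_fst (M : DGMesh d ι) {e : ι × ι} (he : e ∈ M.faces) :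
    IsOutwardNormal (M.elem e.1) (M.face e) (M.normal e) :=
  ⟨M.normal_norm e he, M.normal_fst e he⟩

theorem isOutwardNormal_snd (M : DGMesh d ι) {e : ι × ι} (he : e ∈ M.faces) :
    IsOutwardNormal (M.elem e.2) (M.face e) (-M.normal e) :=
  ⟨by rw [norm_neg, M.normal_norm e he], fun x hx y hy => by
    rw [inner_neg_left, neg_nonpos]
    exact M.normal_snd e he x hx y hy⟩

/-- The two elements that share a facet lie on different sides of it. -/
theorem exists_isOutwardNormal (M : DGMesh d ι) {K K' : ι} (hne : K ≠ K')
    (hF : IsFacet (M.elem K) (M.elem K ∩ M.elem K')) :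
    ∃ n, IsOutwardNormal (M.elem K) (M.elem K ∩ M.elem K') n ∧
      IsOutwardNormal (M.elem K') (M.elem K ∩ M.elem K') (-n) := by
  rcases (M.faces_xor K K' hne hF).or with he | he
  · exact ⟨_, M.isOutwardNormal_fst he, M.isOutwardNormal_snd he⟩
  · refine ⟨-M.normal (K', K), ?_, ?_⟩
    · rw [inter_comm]
      exact M.isOutwardNormal_snd he
    · rw [inter_comm, neg_neg]
      exact M.isOutwardNormal_fst he

/-- Two elements that share the same facet with a third one both lie on the other side of it, so
they overlap and conformity makes them equal. -/
theorem neighbour_unique (M : DGMesh d ι) {K K' K'' : ι} (h' : K ≠ K') (h'' : K ≠ K'')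
    (hF : IsFacet (M.elem K) (M.elem K ∩ M.elem K'))
    (heq : M.elem K ∩ M.elem K' = M.elem K ∩ M.elem K'') : K' = K'' := by
  obtain ⟨n, hn, hn'⟩ := M.exists_isOutwardNormal h' hF
  obtain ⟨m, hm, hm''⟩ := M.exists_isOutwardNormal h'' (heq ▸ hF)
  rw [← heq] at hm hm''
  have hi := fun K => (M.isCell K).interior_nonempty
  have hc := fun K => (M.isCell K).convex
  obtain rfl := IsOutwardNormal.unique hF (hi K) hn hm
  by_contra hne
  have hFK' : M.elem K ∩ M.elem K' ⊆ M.elem K' := inter_subset_right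
  have hFK'' : M.elem K ∩ M.elem K' ⊆ M.elem K'' := heq ▸ inter_subset_right
  have h1 := eq_inter_of_common_facet (hc K') (hc K'') (hi K') (hi K'') hF.1
    (hF.convex (hc K)) hF.2.2 hFK' hFK'' hn' hm'' (M.conforming _ _ hne).1
  have h2 := eq_inter_of_common_facet (hc K'') (hc K') (hi K'') (hi K') hF.1
    (hF.convex (hc K)) hF.2.2 hFK'' hFK' hm'' hn' (M.conforming _ _ (Ne.symm hne)).1
  rw [inter_comm] at h2
  exact hne (M.elem_injective (h1.symm.trans h2))

/-- Different interior faces of an element are different sets. -/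
theorem injOn_face (M : DGMesh d ι) (K : ι) :
    InjOn M.face {e | e ∈ M.faces ∧ (e.1 = K ∨ e.2 = K)} := by
  rintro ⟨a, b⟩ ⟨he, h⟩ ⟨a', b'⟩ ⟨he', h'⟩ heq
  have hab := (M.faces_facet _ he).1
  have hab' := (M.faces_facet _ he').1
  have hF := M.isFacet_fst he
  have hF2 := M.isFacet_snd he
  simp only [face] at heq hab hab' hF hF2
  rcases h with rfl | rfl <;> rcases h' with rfl | h'
  · rw [M.neighbour_unique hab hab' hF heq]
  · simp only at h'
    subst h'
    obtain rfl := M.neighbour_unique hab hab'.symm hF (by rw [heq, inter_comm])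
    rcases M.faces_xor _ _ hab hF with h | h
    · exact absurd he' h.2
    · exact absurd he h.2
  · rw [inter_comm] at hF2 heq
    obtain rfl := M.neighbour_unique hab.symm hab' hF2 heq
    rw [inter_comm] at hF2
    rcases M.faces_xor _ _ hab hF with h | h
    · exact absurd he' h.2
    · exact absurd he h.2
  · simp only at h'
    subst h'
    rw [inter_comm] at hF2 heq
    rw [M.neighbour_unique hab.symm hab'.symm hF2 (by rw [heq, inter_comm])]

theorem interior_elem_subset_domain (M : DGMesh d ι) (K : ι) :
    interior (M.elem K) ⊆ M.domain := interior_mono (subset_iUnion _ K)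

/-- Two different elements that do not share a facet meet in a set of codimension at least two. -/
theorem finrank_vectorSpan_inter_le (M : DGMesh d ι) {K K' : ι} (hne : K ≠ K')
    (hx : (M.elem K ∩ M.elem K').Nonempty) (hF : ¬ IsFacet (M.elem K) (M.elem K ∩ M.elem K')) :
    Module.finrank ℝ (vectorSpan ℝ (M.elem K ∩ M.elem K')) + 1 < d := by
  have hle : Module.finrank ℝ (vectorSpan ℝ (M.elem K ∩ M.elem K')) ≤ d := by
    simpa using (vectorSpan ℝ (M.elem K ∩ M.elem K')).finrank_le
  have hc := M.conforming _ _ hne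
  have h1 : Module.finrank ℝ (vectorSpan ℝ (M.elem K ∩ M.elem K')) + 1 ≠ d :=
    fun h => hF ⟨hx, hc.1, h⟩
  have h2 : Module.finrank ℝ (vectorSpan ℝ (M.elem K ∩ M.elem K')) ≠ d := fun h =>
    hne (M.elem_injective ((hc.1.eq_of_finrank_eq hx h).symm.trans (hc.2.eq_of_finrank_eq hx h)))
  omega

/-- Since the domain is connected, any two elements are joined by a chain of elements in which
consecutive ones share a facet: a property that is passed on through interior faces holds for all
elements or for none. Otherwise there would be, near a point of the domain where elements with and
without the property meet, a segment between two such elements. A generic such segment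
avoids all intersections of elements of codimension two or more, hence it crosses from one kind of
elements to the other one through an interior face. -/
theorem forall_of_forall_faces_iff (M : DGMesh d ι) (hΩ : IsConnected M.domain) {p : ι → Prop}
    (hp : ∀ e ∈ M.faces, (p e.1 ↔ p e.2)) {K₀ : ι} (h₀ : p K₀) (K : ι) : p K := by
  by_contra hK
  have hcl : ∀ q : ι → Prop, IsClosed (⋃ K, ⋃ _ : q K, M.elem K) := fun q =>
    isClosed_iUnion_of_finite fun K => isClosed_iUnion_of_finite fun _ =>
      (M.isCell K).isCompact.isClosed
  have hcover : (⋃ K, M.elem K) ⊆ (⋃ K, ⋃ _ : p K, M.elem K) ∪ (⋃ K, ⋃ _ : ¬ p K, M.elem K) := by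
    intro x hx
    obtain ⟨K, hx⟩ := mem_iUnion.1 hx
    by_cases h : p K
    · exact Or.inl (mem_iUnion₂.2 ⟨K, h, hx⟩)
    · exact Or.inr (mem_iUnion₂.2 ⟨K, h, hx⟩)
  have hmeet : ∀ q : ι → Prop, ∀ K, q K →
      (M.domain ∩ (⋃ K, ⋃ _ : q K, M.elem K)).Nonempty := by
    intro q K hq
    obtain ⟨x, hx⟩ := (M.isCell K).interior_nonempty
    exact ⟨x, M.interior_elem_subset_domain K hx, mem_iUnion₂.2 ⟨K, hq, interior_subset hx⟩⟩
  obtain ⟨x, hxΩ, hxA, hxB⟩ := isPreconnected_closed_iff.1 hΩ.isPreconnected _ _ (hcl p)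
    (hcl fun K => ¬ p K) (interior_subset.trans hcover) (hmeet p K₀ h₀)
    (hmeet (fun K => ¬ p K) K hK)
  obtain ⟨K₁, hK₁, hx₁⟩ := mem_iUnion₂.1 hxA
  obtain ⟨K₂, hK₂, hx₂⟩ := mem_iUnion₂.1 hxB
  obtain ⟨ε, hε, hb⟩ := Metric.isOpen_iff.1 (isOpen_interior (s := ⋃ K, M.elem K)) x hxΩ
  -- a generic point of an element near `x`
  have hgen : ∀ (K : ι), x ∈ M.elem K → ∀ (T : Set (AffineSubspace ℝ (E d))), T.Finite →
      (∀ L ∈ T, L ≠ ⊤) → ∃ y ∈ M.elem K ∩ Metric.ball x ε, ∀ L ∈ T, y ∉ L := by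
    intro K hx T hT hL
    have hopen : IsOpen (interior (M.elem K) ∩ Metric.ball x ε) :=
      isOpen_interior.inter Metric.isOpen_ball
    have hne : (interior (M.elem K) ∩ Metric.ball x ε).Nonempty := by
      have hx' : x ∈ closure (interior (M.elem K)) := by
        rw [(M.isCell K).convex.closure_interior_eq_closure_of_nonempty_interior
          (M.isCell K).interior_nonempty]
        exact subset_closure hx
      rw [inter_comm]
      exact mem_closure_iff.1 hx' _ Metric.isOpen_ball (Metric.mem_ball_self hε)
    by_contra! hcon
    have hsub : interior (M.elem K) ∩ Metric.ball x ε ⊆ ⋃ L ∈ T, (L : Set (E d)) := by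
      intro y hy
      obtain ⟨L, hL, hyL⟩ := hcon y ⟨interior_subset hy.1, hy.2⟩
      exact mem_iUnion₂.2 ⟨L, hL, hyL⟩
    have hz : volume (⋃ L ∈ T, (L : Set (E d))) = 0 :=
      (measure_biUnion_null_iff hT.countable).2 fun L hLT =>
        Measure.addHaar_affineSubspace _ _ (hL L hLT)
    exact (hopen.measure_pos volume hne).ne' (measure_mono_null hsub hz)
  let bad : Set (ι × ι) := {q | (M.elem q.1 ∩ M.elem q.2).Nonempty ∧
    Module.finrank ℝ (vectorSpan ℝ (M.elem q.1 ∩ M.elem q.2)) + 1 < d}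
  have hbad : bad.Finite := toFinite _
  obtain ⟨y, ⟨hy₁, hyb⟩, hyT⟩ := hgen K₁ hx₁
    ((fun q : ι × ι => affineSpan ℝ (M.elem q.1 ∩ M.elem q.2)) '' bad) (hbad.image _) (by
      rintro _ ⟨q, hq, rfl⟩ htop
      beta_reduce at htop
      have h1 := hq.2
      rw [← direction_affineSpan, htop, AffineSubspace.direction_top, finrank_top,
        finrank_euclideanSpace_fin] at h1
      omega)
  obtain ⟨z, ⟨hz₂, hzb⟩, hzT⟩ := hgen K₂ hx₂
    ((fun q : ι × ι => affineSpan ℝ (insert y (affineSpan ℝ (M.elem q.1 ∩ M.elem q.2) :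
      Set (E d)))) '' bad) (hbad.image _) (by
      rintro _ ⟨q, hq, rfl⟩ htop
      beta_reduce at htop
      have h1 := hq.2
      have h2 := finrank_vectorSpan_insert_le (affineSpan ℝ (M.elem q.1 ∩ M.elem q.2)) y
      rw [← direction_affineSpan ℝ (insert y _), htop, AffineSubspace.direction_top, finrank_top,
        finrank_euclideanSpace_fin, direction_affineSpan] at h2
      omega)
  have hseg : segment ℝ y z ⊆ ⋃ K, M.elem K :=
    ((convex_ball x ε).segment_subset hyb hzb).trans (hb.trans interior_subset)
  obtain ⟨w, hw, hwA, hwB⟩ :=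
    isPreconnected_closed_iff.1 (convex_segment (𝕜 := ℝ) y z).isPreconnected _ _
    (hcl p) (hcl fun K => ¬ p K) (hseg.trans hcover)
    ⟨y, left_mem_segment ℝ y z, mem_iUnion₂.2 ⟨K₁, hK₁, hy₁⟩⟩
    ⟨z, right_mem_segment ℝ y z, mem_iUnion₂.2 ⟨K₂, hK₂, hz₂⟩⟩
  obtain ⟨K₃, hK₃, hw₃⟩ := mem_iUnion₂.1 hwA
  obtain ⟨K₄, hK₄, hw₄⟩ := mem_iUnion₂.1 hwB
  have hne : K₃ ≠ K₄ := by
    rintro rfl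
    exact hK₄ hK₃
  by_cases hF : IsFacet (M.elem K₃) (M.elem K₃ ∩ M.elem K₄)
  · rcases (M.faces_xor _ _ hne hF).or with he | he
    · exact hK₄ ((hp _ he).1 hK₃)
    · exact hK₄ ((hp _ he).2 hK₃)
  · have hq : (K₃, K₄) ∈ bad :=
      ⟨⟨w, hw₃, hw₄⟩, M.finrank_vectorSpan_inter_le hne ⟨w, hw₃, hw₄⟩ hF⟩
    have hwL : w ∈ affineSpan ℝ (M.elem K₃ ∩ M.elem K₄) := subset_affineSpan ℝ _ ⟨hw₃, hw₄⟩
    have hyw : y ≠ w := by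
      rintro rfl
      exact hyT _ ⟨_, hq, rfl⟩ hwL
    -- `z` lies on the line through `y` and `w`
    refine hzT _ ⟨_, hq, rfl⟩ ?_
    rw [segment_eq_image_lineMap] at hw
    obtain ⟨t, -, rfl⟩ := hw
    have ht : t ≠ 0 := by
      rintro rfl
      simp at hyw
    have hz : z = AffineMap.lineMap y (AffineMap.lineMap y z t) t⁻¹ := by
      simp [AffineMap.lineMap_apply, smul_smul, inv_mul_cancel₀ ht]
    simp only
    rw [hz]
    exact AffineMap.lineMap_mem _ (subset_affineSpan ℝ _ (mem_insert _ _))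
      (subset_affineSpan ℝ _ (mem_insert_of_mem _ hwL))

end DGMesh

/-! ### The local polynomial spaces -/

instance finiteDimensional_localSpace (d : ℕ) (t : CellType) :
    FiniteDimensional ℝ (localSpace d t) := by
  cases t with
  | simplex => exact FiniteDimensional.span_of_finite ℝ (toFinite _)
  | cube => exact FiniteDimensional.span_of_finite ℝ (toFinite _)

theorem localSpace_le_cube (d : ℕ) (t : CellType) : localSpace d t ≤ localSpace d .cube := by
  cases t with
  | simplex => exact Submodule.span_mono (image_subset_range _ _)
  | cube => exact le_rfl

theorem analyticOnNhd_of_mem_localSpace {d : ℕ} {t : CellType} {w : E d → ℝ}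
    (hw : w ∈ localSpace d t) : AnalyticOnNhd ℝ w univ := by
  replace hw := localSpace_le_cube d t hw
  induction hw using Submodule.span_induction with
  | mem w hw =>
    obtain ⟨S, rfl⟩ := hw
    exact Finset.analyticOnNhd_fun_prod S fun i _ =>
      (EuclideanSpace.proj (𝕜 := ℝ) i : E d →L[ℝ] ℝ).analyticOnNhd univ
  | zero => exact analyticOnNhd_const
  | add u v _ _ hu hv => exact hu.add hv
  | smul c u _ hu => exact (analyticOnNhd_const (v := c)).smul hu

theorem contDiff_of_mem_localSpace {d : ℕ} {t : CellType} {w : E d → ℝ}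
    (hw : w ∈ localSpace d t) : ContDiff ℝ 1 w :=
  (analyticOnNhd_of_mem_localSpace hw).contDiff

theorem continuous_of_mem_localSpace {d : ℕ} {t : CellType} {w : E d → ℝ}
    (hw : w ∈ localSpace d t) : Continuous w := (contDiff_of_mem_localSpace hw).continuous

theorem differentiable_of_mem_localSpace {d : ℕ} {t : CellType} {w : E d → ℝ}
    (hw : w ∈ localSpace d t) : Differentiable ℝ w :=
  (contDiff_of_mem_localSpace hw).differentiable one_ne_zero

theorem inner_gradient {d : ℕ} (w : E d → ℝ) (x v : E d) :
    inner ℝ (gradient w x) v = fderiv ℝ w x v := by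
  simp [gradient]

theorem gradient_add {d : ℕ} {u v : E d → ℝ} (hu : Differentiable ℝ u) (hv : Differentiable ℝ v)
    (x : E d) : gradient (u + v) x = gradient u x + gradient v x := by
  simp [gradient, fderiv_add (hu x) (hv x)]

theorem gradient_smul {d : ℕ} {u : E d → ℝ} (hu : Differentiable ℝ u) (c : ℝ) (x : E d) :
    gradient (c • u) x = c • gradient u x := by
  simp [gradient, fderiv_const_smul (hu x) c]

theorem continuous_gradient {d : ℕ} {w : E d → ℝ} (hw : ContDiff ℝ 1 w) :
    Continuous (gradient w) :=
  (InnerProductSpace.toDual ℝ (E d)).symm.continuous.comp (hw.continuous_fderiv one_ne_zero)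

/-- Directional derivatives of functions in `ℚ₁` are in `ℚ₁`. -/
theorem inner_gradient_mem_localSpace_cube {d : ℕ} {w : E d → ℝ} (hw : w ∈ localSpace d .cube)
    (v : E d) : (fun x => inner ℝ (gradient w x) v) ∈ localSpace d .cube := by
  have hdiff : ∀ {u}, u ∈ localSpace d .cube → Differentiable ℝ u :=
    differentiable_of_mem_localSpace
  induction hw using Submodule.span_induction with
  | mem w hw =>
    obtain ⟨S, rfl⟩ := hw
    have h : (fun x => inner ℝ (gradient (multiMonomial S) x) v) =
        ∑ i ∈ S, v i • multiMonomial (S.erase i) := by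
      ext x
      have hd : HasFDerivAt (multiMonomial S) (∑ i ∈ S, (∏ j ∈ S.erase i, x j) •
          (EuclideanSpace.proj (𝕜 := ℝ) i : E d →L[ℝ] ℝ)) x :=
        HasFDerivAt.finsetProd fun i _ =>
          (EuclideanSpace.proj (𝕜 := ℝ) i : E d →L[ℝ] ℝ).hasFDerivAt
      rw [inner_gradient, hd.fderiv]
      simp [multiMonomial, mul_comm]
    rw [h]
    exact Submodule.sum_mem _ fun i _ => Submodule.smul_mem _ _ (Submodule.subset_span ⟨_, rfl⟩)
  | zero =>
    have : (fun x : E d => inner ℝ (gradient (0 : E d → ℝ) x) v) = 0 := by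
      ext x
      simp [gradient]
    rw [this]
    exact Submodule.zero_mem _
  | add u w hu' hw' hu hw =>
    have : (fun x : E d => inner ℝ (gradient (u + w) x) v) =
        (fun x => inner ℝ (gradient u x) v) + fun x => inner ℝ (gradient w x) v := by
      ext x
      rw [gradient_add (hdiff hu') (hdiff hw'), inner_add_left]
      rfl
    rw [this]
    exact Submodule.add_mem _ hu hw
  | smul c u hu' hu =>
    have : (fun x : E d => inner ℝ (gradient (c • u) x) v) =
        c • fun x => inner ℝ (gradient u x) v := by
      ext x
      rw [gradient_smul (hdiff hu'), inner_smul_left]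
      rfl
    rw [this]
    exact Submodule.smul_mem _ _ hu

theorem gradient_affine {d : ℕ} (a : ℝ) (b x : E d) :
    gradient (fun x => a + inner ℝ b x) x = b := by
  have h : HasFDerivAt (fun x : E d => a + inner ℝ b x) (InnerProductSpace.toDual ℝ (E d) b) x := by
    exact ((InnerProductSpace.toDual ℝ (E d) b).hasFDerivAt (x := x)).const_add a
  simp [gradient, h.fderiv]

theorem affine_mem_localSpace_simplex {d : ℕ} (a : ℝ) (b : E d) :
    (fun x => a + inner ℝ b x) ∈ localSpace d .simplex := by
  have h : (fun x : E d => a + inner ℝ b x) =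
      a • multiMonomial ∅ + ∑ i, b i • multiMonomial {i} := by
    ext x
    simp [multiMonomial, PiLp.inner_apply, mul_comm]
  rw [h]
  refine Submodule.add_mem _ (Submodule.smul_mem _ _ (Submodule.subset_span ⟨∅, by simp, rfl⟩))
    (Submodule.sum_mem _ fun i _ => Submodule.smul_mem _ _
      (Submodule.subset_span ⟨{i}, by simp, rfl⟩))

theorem exists_affine_of_mem_localSpace_simplex {d : ℕ} {w : E d → ℝ}
    (hw : w ∈ localSpace d .simplex) : ∃ (a : ℝ) (b : E d), w = fun x => a + inner ℝ b x := by
  induction hw using Submodule.span_induction with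
  | mem w hw =>
    obtain ⟨S, hS, rfl⟩ := hw
    rcases Nat.le_one_iff_eq_zero_or_eq_one.1 hS with h | h
    · rw [Finset.card_eq_zero] at h
      subst h
      exact ⟨1, 0, by ext; simp [multiMonomial]⟩
    · obtain ⟨i, rfl⟩ := Finset.card_eq_one.1 h
      exact ⟨0, EuclideanSpace.single i 1, by
        ext
        simp [multiMonomial, EuclideanSpace.inner_single_left]⟩
  | zero => exact ⟨0, 0, by ext; simp⟩
  | add u v _ _ hu hv =>
    obtain ⟨a, b, rfl⟩ := hu
    obtain ⟨a', b', rfl⟩ := hv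
    exact ⟨a + a', b + b', by ext; simp [inner_add_left]; ring⟩
  | smul c u _ hu =>
    obtain ⟨a, b, rfl⟩ := hu
    exact ⟨c * a, c • b, by ext; simp [inner_smul_left]; ring⟩

/-- A polynomial that vanishes almost everywhere on an element is zero. -/
theorem eq_zero_of_ae_eq_zero {d : ℕ} {t : CellType} {K : Set (E d)} (hK : (interior K).Nonempty)
    {w : E d → ℝ} (hw : w ∈ localSpace d t) (h : w =ᵐ[volume.restrict K] 0) : w = 0 := by
  have h1 : EqOn w 0 (interior K) := Measure.eqOn_open_of_ae_eq (μ := volume)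
    (ae_restrict_of_ae_restrict_of_subset interior_subset h) isOpen_interior
    (continuous_of_mem_localSpace hw).continuousOn continuousOn_const
  obtain ⟨z, hz⟩ := hK
  have h2 := (analyticOnNhd_of_mem_localSpace hw).eqOn_of_preconnected_of_eventuallyEq
    (g := 0) analyticOnNhd_const isPreconnected_univ (mem_univ z)
    (Filter.mem_of_superset (isOpen_interior.mem_nhds hz) h1)
  ext x
  exact h2 (mem_univ x)

/-- A polynomial whose gradient vanishes almost everywhere on an element is constant. -/
theorem exists_eq_const_of_gradient_ae_eq_zero {d : ℕ} {t : CellType} {K : Set (E d)}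
    (hK : (interior K).Nonempty) {w : E d → ℝ} (hw : w ∈ localSpace d t)
    (h : ∀ᵐ x ∂volume.restrict K, gradient w x = 0) : ∃ c : ℝ, w = fun _ => c := by
  have h1 : ∀ x, fderiv ℝ w x = 0 := by
    intro x
    ext v
    have h2 : (fun x => inner ℝ (gradient w x) v) = 0 :=
      eq_zero_of_ae_eq_zero hK
        (inner_gradient_mem_localSpace_cube (localSpace_le_cube d t hw) v) (by
          filter_upwards [h] with x hx
          simp [hx])
    have h3 := congrFun h2 x
    rw [inner_gradient] at h3
    simpa using h3
  exact ⟨w 0, funext fun x =>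
    is_const_of_fderiv_eq_zero (differentiable_of_mem_localSpace hw) h1 x 0⟩

/-! ### Discrete trace inequalities -/

theorem memLp_of_continuous {d : ℕ} {μ : Measure (E d)} {F : Set (E d)} (hF : IsCompact F)
    (hμ : μ F < ⊤) {f : E d → ℝ} (hf : Continuous f) (p : ENNReal) :
    MemLp f p (μ.restrict F) := by
  have : IsFiniteMeasure (μ.restrict F) := ⟨by simpa using hμ⟩
  obtain ⟨C, hC⟩ := hF.exists_bound_of_continuousOn hf.continuousOn
  exact MemLp.of_bound hf.aestronglyMeasurable C
    ((ae_restrict_iff' hF.measurableSet).2 (Filter.Eventually.of_forall hC))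

theorem integrableOn_of_continuous {d : ℕ} {μ : Measure (E d)} {F : Set (E d)} (hF : IsCompact F)
    (hμ : μ F < ⊤) {f : E d → ℝ} (hf : Continuous f) : IntegrableOn f F μ :=
  memLp_one_iff_integrable.1 (memLp_of_continuous hF hμ hf 1)

theorem norm_toLp_two {α : Type*} [MeasurableSpace α] {μ : Measure α} {f : α → ℝ}
    (hf : MemLp f 2 μ) : ‖hf.toLp f‖ = √(∫ x, f x ^ 2 ∂μ) := by
  rw [eq_comm, Real.sqrt_eq_iff_mul_self_eq (integral_nonneg fun x => sq_nonneg _) (norm_nonneg _),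
    ← real_inner_self_eq_norm_mul_norm, L2.inner_def]
  refine integral_congr_ae ?_
  filter_upwards [hf.coeFn_toLp] with x hx
  simp [hx, sq]

/-- On a finite-dimensional space of functions, an `L²` seminorm that is a norm dominates
every other `L²` seminorm. -/
theorem exists_sqrt_integral_sq_le {α : Type*} [MeasurableSpace α] {μ ν : Measure α}
    (V : Submodule ℝ (α → ℝ)) [FiniteDimensional ℝ V] (hμ : ∀ w ∈ V, MemLp w 2 μ)
    (hν : ∀ w ∈ V, MemLp w 2 ν) (hinj : ∀ w ∈ V, w =ᵐ[μ] 0 → w = 0) :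
    ∃ C : ℝ, 0 ≤ C ∧ ∀ w ∈ V, √(∫ x, w x ^ 2 ∂ν) ≤ C * √(∫ x, w x ^ 2 ∂μ) := by
  let T : V →ₗ[ℝ] Lp ℝ 2 μ :=
    { toFun := fun w => (hμ w w.2).toLp w
      map_add' := fun u v => MemLp.toLp_add (hμ u u.2) (hμ v v.2)
      map_smul' := fun c u => MemLp.toLp_const_smul c (hμ u u.2) }
  let S : V →ₗ[ℝ] Lp ℝ 2 ν :=
    { toFun := fun w => (hν w w.2).toLp w
      map_add' := fun u v => MemLp.toLp_add (hν u u.2) (hν v v.2)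
      map_smul' := fun c u => MemLp.toLp_const_smul c (hν u u.2) }
  have hT : Function.Injective T := by
    rw [← LinearMap.ker_eq_bot, LinearMap.ker_eq_bot']
    intro w hw
    have h1 : (w : α → ℝ) =ᵐ[μ] 0 := by
      filter_upwards [(hμ w w.2).coeFn_toLp, (Lp.eq_zero_iff_ae_eq_zero).1 hw] with x h1 h2
      rw [← h1]
      exact h2
    exact Subtype.ext (hinj w w.2 h1)
  let e := LinearEquiv.ofInjective T hT
  let L : LinearMap.range T →L[ℝ] Lp ℝ 2 ν := LinearMap.toContinuousLinearMap (S ∘ₗ e.symm)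
  refine ⟨‖L‖, L.opNorm_nonneg, fun w hw => ?_⟩
  have h := L.le_opNorm (e ⟨w, hw⟩)
  have h1 : L (e ⟨w, hw⟩) = (hν w hw).toLp w := by
    change S (e.symm (e ⟨w, hw⟩)) = _
    rw [e.symm_apply_apply]
    rfl
  have h2 : ‖e ⟨w, hw⟩‖ = ‖(hμ w hw).toLp w‖ := rfl
  rwa [h1, h2, norm_toLp_two, norm_toLp_two] at h

theorem IsCell.diam_pos {d : ℕ} (hd : d ≠ 0) {t : CellType} {K : Set (E d)} (h : IsCell t K) :
    0 < Metric.diam K := by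
  refine Metric.diam_pos ?_ h.isCompact.isBounded
  by_contra hK
  rw [not_nontrivial_iff] at hK
  have h1 := (h.convex.interior_nonempty_iff_affineSpan_eq_top).1 h.interior_nonempty
  have h2 : vectorSpan ℝ K = ⊥ := by
    rw [vectorSpan_eq_bot_iff_subsingleton]
    exact hK
  rw [← direction_affineSpan, h1, AffineSubspace.direction_top] at h2
  have h3 : Module.finrank ℝ (⊤ : Submodule ℝ (E d)) = 0 := by rw [h2, finrank_bot]
  rw [finrank_top, finrank_euclideanSpace_fin] at h3
  exact hd h3

theorem IsFacet.diam_pos {d : ℕ} (hd : 2 ≤ d) {K F : Set (E d)} (hK : IsCompact K)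
    (h : IsFacet K F) : 0 < Metric.diam F := by
  refine Metric.diam_pos ?_ (h.isCompact hK).isBounded
  by_contra hF
  rw [not_nontrivial_iff] at hF
  have h2 : vectorSpan ℝ F = ⊥ := by
    rw [vectorSpan_eq_bot_iff_subsingleton]
    exact hF
  have h3 := h.2.2
  rw [h2, finrank_bot] at h3
  omega

theorem IsFacet.diam_le {d : ℕ} {K F : Set (E d)} (hK : IsCompact K)
    (h : IsFacet K F) : Metric.diam F ≤ Metric.diam K :=
  Metric.diam_mono h.subset hK.isBounded

theorem IsFacet.measure_lt_top {d : ℕ} {K F : Set (E d)} (hK : IsCompact K) (h : IsFacet K F) :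
    (μHE[d - 1] : Measure (E d)) F < ⊤ :=
  euclideanHausdorffMeasure_lt_top (h.isCompact hK) h.1 h.2.2

theorem IsFacet.measure_pos {d : ℕ} {K F : Set (E d)} (hK : Convex ℝ K) (h : IsFacet K F) :
    0 < (μHE[d - 1] : Measure (E d)) F :=
  euclideanHausdorffMeasure_pos (h.convex hK) h.1 h.2.2

theorem IsFacet.integrableOn {d : ℕ} {K F : Set (E d)} (hK : IsCompact K) (h : IsFacet K F)
    {f : E d → ℝ} (hf : Continuous f) : IntegrableOn f F μHE[d - 1] :=
  integrableOn_of_continuous (h.isCompact hK) (h.measure_lt_top hK) hf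

namespace DGMesh

variable {d : ℕ} {ι : Type*} [Fintype ι]

theorem mem_localSpace (M : DGMesh d ι) {w : ι → E d → ℝ} (hw : w ∈ M.X) (K : ι) :
    w K ∈ localSpace d M.cell := hw K (mem_univ K)

theorem exists_isTraceConstant (M : DGMesh d ι) (hd : d ≠ 0) :
    ∃ C : ℝ, 0 < C ∧ M.IsTraceConstant C := by
  classical
  have hloc : ∀ q : ι × Set (E d), ∃ C : ℝ, 0 ≤ C ∧ (IsFacet (M.elem q.1) q.2 →
      ∀ w ∈ localSpace d M.cell, √(∫ x in q.2, w x ^ 2 ∂μHE[d - 1]) ≤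
        C * √(∫ x in M.elem q.1, w x ^ 2)) := by
    rintro ⟨K, F⟩
    by_cases hF : IsFacet (M.elem K) F
    · have hK := M.isCell K
      obtain ⟨C, hC, h⟩ := exists_sqrt_integral_sq_le (μ := volume.restrict (M.elem K))
        (ν := (μHE[d - 1] : Measure (E d)).restrict F) (localSpace d M.cell)
        (fun w hw => memLp_of_continuous hK.isCompact hK.isCompact.measure_lt_top
          (continuous_of_mem_localSpace hw) 2)
        (fun w hw => memLp_of_continuous (hF.isCompact hK.isCompact)
          (hF.measure_lt_top hK.isCompact) (continuous_of_mem_localSpace hw) 2)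
        (fun w hw => eq_zero_of_ae_eq_zero hK.interior_nonempty hw)
      exact ⟨C, hC, fun _ => h⟩
    · exact ⟨0, le_rfl, fun h => absurd h hF⟩
  choose C hC hle using hloc
  have hfin : {q : ι × Set (E d) | IsFacet (M.elem q.1) q.2}.Finite := by
    have : {q : ι × Set (E d) | IsFacet (M.elem q.1) q.2} =
        ⋃ K, (fun F => (K, F)) '' {F | IsFacet (M.elem K) F} := by
      ext ⟨K, F⟩
      simp
    rw [this]
    exact finite_iUnion fun K => ((M.isCell K).finite_setOf_isFacet).image _
  set S := hfin.toFinset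
  have hterm : ∀ q, 0 ≤ C q * √(Metric.diam (M.elem q.1)) := fun q => by
    have := hC q
    positivity
  refine ⟨∑ q ∈ S, C q * √(Metric.diam (M.elem q.1)) + 1, ?_, ?_⟩
  · have := Finset.sum_nonneg (s := S) fun q _ => hterm q
    linarith
  · intro w hw K F hF
    have hdiam := (M.isCell K).diam_pos hd
    have h1 := hle (K, F) hF (w K) (M.mem_localSpace hw K)
    have h2 : C (K, F) * √(Metric.diam (M.elem K)) ≤
        ∑ q ∈ S, C q * √(Metric.diam (M.elem q.1)) :=
      Finset.single_le_sum (f := fun q => C q * √(Metric.diam (M.elem q.1)))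
        (fun q _ => hterm q) (hfin.mem_toFinset.2 hF)
    refine h1.trans ?_
    gcongr
    rw [← div_eq_mul_inv, le_div_iff₀ (Real.sqrt_pos.2 hdiam)]
    linarith

/-- The trace inequality for a single local polynomial, with squared norms. -/
theorem IsTraceConstant.integral_sq_le {M : DGMesh d ι} {C : ℝ} (hC : M.IsTraceConstant C)
    {K : ι} {F : Set (E d)} (hF : IsFacet (M.elem K) F) {p : E d → ℝ}
    (hp : p ∈ localSpace d M.cell) :
    ∫ x in F, p x ^ 2 ∂μHE[d - 1] ≤
      C ^ 2 * (Metric.diam (M.elem K))⁻¹ * ∫ x in M.elem K, p x ^ 2 := by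
  have h := hC (fun _ => p) (fun _ _ => hp) K F hF
  have h1 : 0 ≤ ∫ x in F, p x ^ 2 ∂μHE[d - 1] := integral_nonneg fun x => sq_nonneg _
  have h2 : 0 ≤ ∫ x in M.elem K, p x ^ 2 := integral_nonneg fun x => sq_nonneg _
  calc ∫ x in F, p x ^ 2 ∂μHE[d - 1] = √(∫ x in F, p x ^ 2 ∂μHE[d - 1]) ^ 2 :=
        (Real.sq_sqrt h1).symm
    _ ≤ (C * (√(Metric.diam (M.elem K)))⁻¹ * √(∫ x in M.elem K, p x ^ 2)) ^ 2 := by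
        gcongr
    _ = _ := by
        rw [mul_pow, mul_pow, inv_pow, Real.sq_sqrt h2, Real.sq_sqrt Metric.diam_nonneg]

end DGMesh

/-! ### The trace constant of a simplex -/

/-- Change of variables for the homothety with centre `c` and ratio `r`, applied to a function that
is homogeneous of degree `k` about `c`. -/
theorem setIntegral_homothety {d : ℕ} {K : Set (E d)} (hK : MeasurableSet K) (c : E d) {r : ℝ}
    (hr : 0 < r) {f : E d → ℝ} {k : ℕ} (hf : ∀ x, f (AffineMap.homothety c r x) = r ^ k * f x) :
    ∫ x in AffineMap.homothety c r '' K, f x = r ^ (d + k) * ∫ x in K, f x := by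
  have hder : ∀ x ∈ K, HasFDerivWithinAt (AffineMap.homothety c r : E d → E d)
      (r • ContinuousLinearMap.id ℝ (E d)) K x := by
    intro x _
    have h : (AffineMap.homothety c r : E d → E d) = fun y => r • (y - c) + c := by
      ext y
      simp [AffineMap.homothety_apply]
    rw [h]
    exact ((((hasFDerivAt_id x).sub_const c).const_smul r).add_const c).hasFDerivWithinAt
  have hinj : InjOn (AffineMap.homothety c r : E d → E d) K := by
    intro x _ y _ hxy
    simpa [AffineMap.homothety_apply, hr.ne'] using hxy
  rw [integral_image_eq_integral_abs_det_fderiv_smul volume hK hder hinj]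
  have hdet : |(r • ContinuousLinearMap.id ℝ (E d)).det| = r ^ d := by
    have : (r • ContinuousLinearMap.id ℝ (E d)).det = r ^ d := by
      change LinearMap.det (r • (LinearMap.id : E d →ₗ[ℝ] E d)) = _
      rw [LinearMap.det_smul, LinearMap.det_id, finrank_euclideanSpace_fin, mul_one]
    rw [this, abs_of_pos (by positivity)]
  simp_rw [hdet, hf, smul_eq_mul]
  rw [← integral_const_mul]
  congr 1
  ext x
  ring

/-- The affine function with value `1` on a facet of a simplex and `-1` at the opposite vertex has
a small `L²` norm. The moments of the barycentric coordinate are estimated by self-similarity: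
a homothety about the vertex maps the simplex `K` onto a subsimplex `K'`, and the coordinate is
almost constant on `K \ K'`. -/
theorem integral_sq_affine_simplex_le {d : ℕ} (hd : d = 2 ∨ d = 3)
    (b : AffineBasis (Fin (d + 1)) ℝ (E d)) (j : Fin (d + 1)) :
    ∫ x in convexHull ℝ (range b), (1 - 2 * b.coord j x) ^ 2 ≤
      2 / (d + 1) * volume.real (convexHull ℝ (range b)) := by
  set K := convexHull ℝ (range b) with hKdef
  have hKc : IsCompact K := (finite_range b).isCompact_convexHull ℝ
  have hcoord : ∀ x, x ∈ K ↔ ∀ i, 0 ≤ b.coord i x := by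
    intro x
    rw [hKdef, b.convexHull_eq_nonneg_coord]
    rfl
  have hcont : Continuous (b.coord j) := (b.coord j).continuous_of_finiteDimensional
  have hint : ∀ {f : E d → ℝ}, Continuous f → IntegrableOn f K := fun hf =>
    integrableOn_of_continuous hKc hKc.measure_lt_top hf
  have hle1 : ∀ x ∈ K, b.coord j x ≤ 1 := by
    intro x hx
    rw [← b.sum_coord_apply_eq_one x]
    exact Finset.single_le_sum (f := fun i => b.coord i x) (fun i _ => (hcoord x).1 hx i)
      (Finset.mem_univ j)
  -- the limit `r → 1` would give the exact moments; this ratio is close enough to `1`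
  set r : ℝ := 99 / 100 with hr
  have hr0 : 0 < r := by norm_num [hr]
  have hr1 : r < 1 := by norm_num [hr]
  set T := AffineMap.homothety (b j) r with hT
  have hTcoord : ∀ i x, b.coord i (T x) =
      b.coord i (b j) + r * (b.coord i x - b.coord i (b j)) := by
    intro i x
    rw [hT, AffineMap.homothety_eq_lineMap, AffineMap.apply_lineMap, AffineMap.lineMap_apply]
    simp [add_comm]
  have hTj : ∀ x, 1 - b.coord j (T x) = r * (1 - b.coord j x) := by
    intro x
    rw [hTcoord, b.coord_apply_eq]
    ring
  have hTK : T '' K ⊆ K := by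
    rintro _ ⟨x, hx, rfl⟩
    rw [hcoord] at hx ⊢
    intro i
    rw [hTcoord]
    have h1 := hx i
    have h2 : 0 ≤ b.coord i (b j) := by
      rw [b.coord_apply]
      split_ifs <;> norm_num
    nlinarith
  have hTm : MeasurableSet (T '' K) :=
    (hKc.image (AffineMap.continuous_of_finiteDimensional T)).measurableSet
  have hout : ∀ x ∈ K \ T '' K, r ≤ 1 - b.coord j x := by
    rintro x ⟨hx, hxT⟩
    by_contra! hlt
    apply hxT
    refine ⟨AffineMap.homothety (b j) r⁻¹ x, ?_, ?_⟩
    · rw [hcoord] at hx ⊢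
      intro i
      have h3 : b.coord i (AffineMap.homothety (b j) r⁻¹ x) =
          b.coord i (b j) + r⁻¹ * (b.coord i x - b.coord i (b j)) := by
        rw [AffineMap.homothety_eq_lineMap, AffineMap.apply_lineMap, AffineMap.lineMap_apply]
        simp [add_comm]
      rw [h3, b.coord_apply]
      split_ifs with hij
      · subst hij
        have : r⁻¹ * (1 - b.coord i x) ≤ 1 := by
          rw [inv_mul_le_iff₀ hr0]
          linarith
        linarith
      · have := hx i
        simp only [zero_add, sub_zero]
        positivity
    · simp [hT, AffineMap.homothety_apply, smul_smul, hr0.ne']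
  -- self-similarity
  have hself : ∀ {f : E d → ℝ} {k : ℕ}, Continuous f → (∀ x, f (T x) = r ^ k * f x) →
      ∫ x in K \ T '' K, f x = (1 - r ^ (d + k)) * ∫ x in K, f x := by
    intro f k hf hfT
    have h1 := setIntegral_homothety hKc.measurableSet (b j) hr0 hfT
    rw [setIntegral_sdiff hTm (hint hf) hTK, h1]
    ring
  have hμc : Continuous fun x => 1 - b.coord j x := continuous_const.sub hcont
  have hfin : volume (K \ T '' K) < ⊤ :=
    (measure_mono sdiff_subset).trans_lt hKc.measure_lt_top
  have hV0 : volume.real (K \ T '' K) = (1 - r ^ d) * volume.real K := by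
    have := hself (f := fun _ => 1) (k := 0) continuous_const (by simp)
    simpa using this
  set V := volume.real K
  have hV : 0 ≤ V := measureReal_nonneg
  have hDm : MeasurableSet (K \ T '' K) := hKc.measurableSet.diff hTm
  have hI1 : r * ((1 - r ^ d) * V) ≤ (1 - r ^ (d + 1)) * ∫ x in K, (1 - b.coord j x) := by
    rw [← hself (f := fun x => 1 - b.coord j x) (k := 1) hμc (by simpa using hTj), ← hV0]
    have := setIntegral_mono_on (μ := volume) (f := fun _ => r) (integrableOn_const hfin.ne)
      ((hint hμc).mono_set sdiff_subset) hDm hout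
    simpa [mul_comm] using this
  have hI2 : (1 - r ^ (d + 2)) * ∫ x in K, (1 - b.coord j x) ^ 2 ≤ (1 - r ^ d) * V := by
    rw [← hself (f := fun x => (1 - b.coord j x) ^ 2) (k := 2) (hμc.pow 2)
      (fun x => by rw [hTj]; ring), ← hV0]
    have := setIntegral_mono_on (μ := volume) (g := fun _ => (1 : ℝ))
      ((hint (hμc.pow 2)).mono_set sdiff_subset) (integrableOn_const hfin.ne) hDm
      (fun x hx => by
        have h1 := hle1 x hx.1
        have h2 := (hcoord x).1 hx.1 j
        simp only [Pi.pow_apply]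
        nlinarith)
    simpa using this
  have hexp : ∫ x in K, (1 - 2 * b.coord j x) ^ 2 =
      4 * (∫ x in K, (1 - b.coord j x) ^ 2) - 4 * (∫ x in K, (1 - b.coord j x)) + V := by
    have h1 : ∀ x, (1 - 2 * b.coord j x) ^ 2 =
        4 * (1 - b.coord j x) ^ 2 - 4 * (1 - b.coord j x) + 1 := fun x => by ring
    have i1 : IntegrableOn (fun x => 4 * (1 - b.coord j x) ^ 2) K := hint (by fun_prop)
    have i2 : IntegrableOn (fun x => 4 * (1 - b.coord j x)) K := hint (by fun_prop)
    have i3 : IntegrableOn (fun x => 4 * (1 - b.coord j x) ^ 2 - 4 * (1 - b.coord j x)) K :=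
      i1.sub i2
    simp_rw [h1]
    rw [integral_add i3 (hint continuous_const), integral_sub i1 i2,
      integral_const_mul, integral_const_mul]
    simp [V]
  rw [hexp]
  rcases hd with rfl | rfl <;> norm_num [hr] at hI1 hI2 ⊢ <;> linarith

theorem one_sub_two_mul_coord_mem_localSpace {d : ℕ} (b : AffineBasis (Fin (d + 1)) ℝ (E d))
    (j : Fin (d + 1)) :
    (fun x => 1 - 2 * b.coord j x) ∈ localSpace d .simplex := by
  have h : (fun x => 1 - 2 * b.coord j x) = fun x => (1 - 2 * b.coord j 0) +
      inner ℝ ((InnerProductSpace.toDual ℝ (E d)).symm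
        (-(2 : ℝ) • LinearMap.toContinuousLinearMap (b.coord j).linear)) x := by
    ext x
    have h1 : b.coord j x = (b.coord j).linear x + b.coord j 0 := by
      have := (b.coord j).map_vadd 0 x
      simpa using this
    simp only [InnerProductSpace.toDual_symm_apply, h1]
    simp
    ring
  rw [h]
  exact affine_mem_localSpace_simplex _ _

/-- Each facet of a simplex is the zero set of a barycentric coordinate. -/
theorem IsFacet.exists_opposite_vertex {d : ℕ} (b : AffineBasis (Fin (d + 1)) ℝ (E d))
    {F : Set (E d)} (hF : IsFacet (convexHull ℝ (range b)) F) :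
    ∃ j, F = convexHull ℝ (b '' {i | i ≠ j}) := by
  classical
  have h := IsExposed.eq_convexHull_image hF.2.1
  set A := {i | b i ∈ F} with hA
  have hne : A.toFinset.Nonempty := by
    rw [Set.toFinset_nonempty]
    by_contra hcon
    rw [not_nonempty_iff_eq_empty] at hcon
    rw [hcon] at h
    simpa [h] using hF.1
  have hdim := b.ind.finrank_vectorSpan_image_finset (s := A.toFinset) (n := A.toFinset.card - 1)
    (by have := hne.card_pos; omega)
  have hsp : vectorSpan ℝ F = vectorSpan ℝ (b '' A) := by
    rw [h, ← direction_affineSpan, affineSpan_convexHull, direction_affineSpan]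
  have h2 := hF.2.2
  rw [hsp] at h2
  rw [Finset.coe_image, coe_toFinset] at hdim
  have hcard : A.toFinsetᶜ.card = 1 := by
    rw [Finset.card_compl, Fintype.card_fin]
    have := hne.card_pos
    omega
  obtain ⟨j, hj⟩ := Finset.card_eq_one.1 hcard
  refine ⟨j, ?_⟩
  have : A = {i | i ≠ j} := by
    ext i
    have := Finset.ext_iff.1 hj i
    simp at this
    simp [← this]
  rw [h, this]

/-! ### Sums over the facets of an element -/

/-- Distinct facets of a simplex correspond to distinct vertices. -/
theorem card_le_of_isFacet_simplex {d : ℕ} (b : AffineBasis (Fin (d + 1)) ℝ (E d)) {κ : Type*}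
    {S : Finset κ} {φ : κ → Set (E d)} (hφ : ∀ e ∈ S, IsFacet (convexHull ℝ (range b)) (φ e))
    (hinj : InjOn φ S) : S.card ≤ d + 1 := by
  classical
  have h : ∀ e : κ, ∃ j, e ∈ S → φ e = convexHull ℝ (b '' {i | i ≠ j}) := fun e => by
    by_cases he : e ∈ S
    · obtain ⟨j, hj⟩ := (hφ e he).exists_opposite_vertex b
      exact ⟨j, fun _ => hj⟩
    · exact ⟨0, fun h => absurd h he⟩
  choose j hj using h
  have := Finset.card_le_card_of_injOn (s := S) (t := Finset.univ) j (fun _ _ => Finset.mem_univ _)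
    (fun e he e' he' heq => hinj he he' (by rw [hj e he, hj e' he', heq]))
  simpa using this

theorem card_le_of_isFacet_cube {d : ℕ} {K : Set (E d)} (hK : IsCubeCell K) {κ : Type*}
    {S : Finset κ} {φ : κ → Set (E d)} (hφ : ∀ e ∈ S, IsFacet K (φ e))
    (hinj : InjOn φ S) : S.card ≤ 2 * d := by
  classical
  obtain ⟨v, -, -, -, -, hv⟩ := hK
  rcases S.eq_empty_or_nonempty with rfl | ⟨e₀, he₀⟩
  · simp
  obtain ⟨i₀, b₀, -⟩ := (hv _).1 (hφ e₀ he₀)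
  have h : ∀ e : κ, ∃ q : Fin d × Bool, e ∈ S → φ e = convexHull ℝ (v '' {s | s q.1 = q.2}) :=
    fun e => by
      by_cases he : e ∈ S
      · obtain ⟨i, b, h⟩ := (hv _).1 (hφ e he)
        exact ⟨(i, b), fun _ => h⟩
      · exact ⟨(i₀, b₀), fun h => absurd h he⟩
  choose q hq using h
  have := Finset.card_le_card_of_injOn (s := S) (t := Finset.univ) q (fun _ _ => Finset.mem_univ _)
    (fun e he e' he' heq => hinj he he' (by rw [hq e he, hq e' he', heq]))
  simpa [mul_comm] using this

/-- On a simplex the integrand is constant and the trace constant controls the measure of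
the facets, with a factor that compensates for their number. -/
theorem sum_integral_facets_simplex_le {d : ℕ} (hd : d = 2 ∨ d = 3) {ι : Type*} [Fintype ι]
    (M : DGMesh d ι) (hM : M.cell = .simplex) {C : ℝ} (hC : M.IsTraceConstant C) (K : ι)
    {κ : Type*} {S : Finset κ} {φ : κ → Set (E d)} (hφ : ∀ e ∈ S, IsFacet (M.elem K) (φ e))
    (hinj : InjOn φ S) {n : κ → E d} (hn : ∀ e ∈ S, ‖n e‖ = 1) {p : E d → ℝ}
    (hp : p ∈ localSpace d M.cell) :
    ∑ e ∈ S, Metric.diam (φ e) * ∫ x in φ e, inner ℝ (gradient p x) (n e) ^ 2 ∂μHE[d - 1] ≤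
      2 * C ^ 2 * ∫ x in M.elem K, ‖gradient p x‖ ^ 2 := by
  have hcell := M.isCell K
  have hK : IsSimplexCell (M.elem K) := by
    rw [hM] at hcell
    exact hcell
  obtain ⟨b, hb⟩ := hK.exists_affineBasis
  have hdiam : 0 < Metric.diam (M.elem K) := hcell.diam_pos (by omega)
  have hmeas : ∀ F, IsFacet (M.elem K) F → Metric.diam (M.elem K) * (μHE[d - 1]).real F ≤
      C ^ 2 * (2 / (d + 1) * volume.real (M.elem K)) := by
    intro F hF
    obtain ⟨j, hj⟩ := IsFacet.exists_opposite_vertex b (hb ▸ hF)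
    have hmem : (fun x => 1 - 2 * b.coord j x) ∈ localSpace d M.cell := by
      rw [hM]
      exact one_sub_two_mul_coord_mem_localSpace b j
    have h1 := hC.integral_sq_le hF hmem
    have h0 : ∀ x ∈ F, b.coord j x = 0 := by
      intro x hx
      have hcv : Convex ℝ {x | b.coord j x = 0} := by
        have : {x | b.coord j x = 0} = b.coord j ⁻¹' {0} := rfl
        rw [this]
        exact (convex_singleton 0).affine_preimage (b.coord j)
      rw [hj] at hx
      refine convexHull_min ?_ hcv hx
      rintro _ ⟨i, hi, rfl⟩
      exact b.coord_apply_ne (Ne.symm hi)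
    have h2 : ∫ x in F, (1 - 2 * b.coord j x) ^ 2 ∂μHE[d - 1] = (μHE[d - 1]).real F := by
      rw [setIntegral_congr_fun (g := fun _ => (1 : ℝ))
        (hF.isCompact hcell.isCompact).measurableSet (fun x hx => by simp [h0 x hx])]
      simp
    have h3 := integral_sq_affine_simplex_le hd b j
    rw [← hb] at h3
    rw [h2] at h1
    calc Metric.diam (M.elem K) * (μHE[d - 1]).real F
        ≤ Metric.diam (M.elem K) * (C ^ 2 * (Metric.diam (M.elem K))⁻¹ *
            (2 / (d + 1) * volume.real (M.elem K))) := by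
          gcongr
          exact h1.trans (by gcongr)
      _ = _ := by field_simp
  obtain ⟨a, g, rfl⟩ := exists_affine_of_mem_localSpace_simplex (hM ▸ hp)
  simp_rw [gradient_affine]
  simp only [integral_const, MeasurableSet.univ, measureReal_restrict_apply, univ_inter,
    smul_eq_mul]
  set V := volume.real (M.elem K)
  have hV : 0 ≤ V := measureReal_nonneg
  have hterm : ∀ e ∈ S, Metric.diam (φ e) * ((μHE[d - 1]).real (φ e) * inner ℝ g (n e) ^ 2) ≤
      C ^ 2 * (2 / (d + 1) * V) * ‖g‖ ^ 2 := by
    intro e he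
    have h1 : inner ℝ g (n e) ^ 2 ≤ ‖g‖ ^ 2 := by
      rw [sq_le_sq, abs_norm]
      simpa [hn e he] using abs_real_inner_le_norm g (n e)
    calc _ ≤ Metric.diam (M.elem K) * ((μHE[d - 1]).real (φ e) * ‖g‖ ^ 2) := by
          gcongr
          exact (hφ e he).diam_le hcell.isCompact
      _ = Metric.diam (M.elem K) * (μHE[d - 1]).real (φ e) * ‖g‖ ^ 2 := by ring
      _ ≤ _ := mul_le_mul_of_nonneg_right (hmeas _ (hφ e he)) (sq_nonneg _)
  calc _ ≤ ∑ e ∈ S, C ^ 2 * (2 / (d + 1) * V) * ‖g‖ ^ 2 := Finset.sum_le_sum hterm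
    _ = S.card * (C ^ 2 * (2 / (d + 1) * V) * ‖g‖ ^ 2) := by rw [Finset.sum_const, nsmul_eq_mul]
    _ ≤ (d + 1) * (C ^ 2 * (2 / (d + 1) * V) * ‖g‖ ^ 2) := by
        gcongr
        exact_mod_cast card_le_of_isFacet_simplex b (hb ▸ hφ) hinj
    _ = _ := by field_simp

/-- The outward normals of a rectangular box are, up to sign, the vectors of an orthonormal
basis. -/
theorem IsBox.exists_normal_eq {d : ℕ} {K : Set (E d)} {u : OrthonormalBasis (Fin d) ℝ (E d)}
    {c : E d} {l : Fin d → ℝ} (hl : ∀ i, 0 < l i)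
    (hK : K = {x | ∀ i, inner ℝ (u i) (x - c) ∈ Icc 0 (l i)}) {F : Set (E d)} (hF : IsFacet K F)
    {n : E d} (hn : IsOutwardNormal K F n) : ∃ i, n = u i ∨ n = -u i := by
  obtain ⟨i, hi⟩ : ∃ i, inner ℝ (u i) n ≠ 0 := by
    by_contra! hcon
    apply hn.ne_zero
    rw [← u.sum_repr' n]
    simp [hcon]
  -- moving a point of the facet inside the box in the direction `u i`
  have hmove : ∀ x ∈ F, ∀ s ∈ Icc 0 (l i), (s - inner ℝ (u i) (x - c)) * inner ℝ (u i) n ≤ 0 := by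
    intro x hx s hs
    have hy : x + (s - inner ℝ (u i) (x - c)) • u i ∈ K := by
      have hxK := hF.subset hx
      rw [hK] at hxK ⊢
      intro k
      rw [add_sub_right_comm, inner_add_right, inner_smul_right,
        orthonormal_iff_ite.1 u.orthonormal]
      split_ifs with hki
      · subst hki
        simpa using hs
      · simpa using hxK k
    have := hn.2 x hx _ hy
    rwa [add_sub_cancel_left, inner_smul_right, real_inner_comm (u i) n] at this
  have hconst : ∃ s, ∀ x ∈ F, inner ℝ (u i) (x - c) = s := by
    rcases lt_or_gt_of_ne hi with h | h
    · refine ⟨0, fun x hx => ?_⟩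
      have h1 := hmove x hx 0 ⟨le_rfl, (hl i).le⟩
      have h2 := hF.subset hx
      rw [hK] at h2
      have h3 := (h2 i).1
      nlinarith
    · refine ⟨l i, fun x hx => ?_⟩
      have h1 := hmove x hx (l i) ⟨(hl i).le, le_rfl⟩
      have h2 := hF.subset hx
      rw [hK] at h2
      have h3 := (h2 i).2
      nlinarith
  obtain ⟨s, hs⟩ := hconst
  have hu : u i ∈ (vectorSpan ℝ F)ᗮ := by
    refine mem_orthogonal_vectorSpan fun x hx y hy => ?_
    have : y - x = (y - c) - (x - c) := by abel
    rw [this, inner_sub_right, hs x hx, hs y hy, sub_self]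
  obtain ⟨a, ha⟩ := exists_smul_eq_of_mem_orthogonal hF.2.2 (hn.mem_orthogonal hF.subset)
    hn.ne_zero hu
  have h1 : |a| = 1 := by
    have h2 := u.norm_eq_one i
    rwa [ha, norm_smul, hn.1, mul_one, Real.norm_eq_abs] at h2
  refine ⟨i, ?_⟩
  rcases (abs_eq zero_le_one).1 h1 with rfl | rfl
  · left
    simpa using ha.symm
  · right
    simp [ha]

theorem sum_inner_normal_sq_box_le {d : ℕ} {K : Set (E d)} (hK : IsBox K) {κ : Type*}
    {S : Finset κ} {φ : κ → Set (E d)} (hφ : ∀ e ∈ S, IsFacet K (φ e))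
    (hinj : InjOn φ S) {n : κ → E d} (hn : ∀ e ∈ S, IsOutwardNormal K (φ e) (n e)) (g : E d) :
    ∑ e ∈ S, inner ℝ g (n e) ^ 2 ≤ 2 * ‖g‖ ^ 2 := by
  classical
  obtain ⟨u, c, l, hl, hKu⟩ := hK
  rcases S.eq_empty_or_nonempty with rfl | ⟨e₀, he₀⟩
  · simp only [Finset.sum_empty]
    positivity
  obtain ⟨i₀, -⟩ := IsBox.exists_normal_eq hl hKu (hφ e₀ he₀) (hn e₀ he₀)
  have h : ∀ e : κ, ∃ q : Fin d × Bool, e ∈ S → n e = (if q.2 then (1 : ℝ) else -1) • u q.1 := by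
    intro e
    by_cases he : e ∈ S
    · obtain ⟨i, h | h⟩ := IsBox.exists_normal_eq hl hKu (hφ e he) (hn e he)
      · exact ⟨(i, true), fun _ => by simp [h]⟩
      · exact ⟨(i, false), fun _ => by simp [h]⟩
    · exact ⟨(i₀, true), fun h => absurd h he⟩
  choose q hq using h
  have hqinj : InjOn q S := by
    intro e he e' he' heq
    apply hinj he he'
    have : n e = n e' := by rw [hq e he, hq e' he', heq]
    rw [(hφ e he).eq_setOf_inner_le (hn e he), (hφ e' he').eq_setOf_inner_le (hn e' he'), this]
  calc ∑ e ∈ S, inner ℝ g (n e) ^ 2 = ∑ e ∈ S, inner ℝ g (u (q e).1) ^ 2 := by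
        refine Finset.sum_congr rfl fun e he => ?_
        rw [hq e he, inner_smul_right, mul_pow]
        split_ifs <;> simp
    _ = ∑ p ∈ S.image q, inner ℝ g (u p.1) ^ 2 := 
        (Finset.sum_image (f := fun p : Fin d × Bool => inner ℝ g (u p.1) ^ 2) hqinj).symm
    _ ≤ ∑ p : Fin d × Bool, inner ℝ g (u p.1) ^ 2 :=
        Finset.sum_le_sum_of_subset_of_nonneg (Finset.subset_univ _) fun _ _ _ => sq_nonneg _
    _ = 2 * ∑ i, inner ℝ g (u i) ^ 2 := by
        rw [Fintype.sum_prod_type, Finset.mul_sum]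
        simp
    _ = 2 * ‖g‖ ^ 2 := by
        rw [← u.sum_sq_norm_inner_right g]
        simp [real_inner_comm]

/-! ### Quadrilaterals -/

/-- In the plane, the length of an edge `a` times the normal component of `g` is the cross product
of `g` and `a`, a linear functional of `a`. -/
theorem norm_mul_abs_inner_normal {a g n : E 2} (hn : ‖n‖ = 1) (hna : inner ℝ n a = 0) :
    ‖a‖ * |inner ℝ g n| = |g 0 * a 1 - g 1 * a 0| := by
  have h1 : n 0 ^ 2 + n 1 ^ 2 = 1 := by
    have := EuclideanSpace.norm_sq_eq n
    simpa [hn, Fin.sum_univ_two] using this.symm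
  have h2 : a 0 * n 0 + a 1 * n 1 = 0 := by
    simpa [PiLp.inner_apply, Fin.sum_univ_two] using hna
  have h3 : inner ℝ g n = g 0 * n 0 + g 1 * n 1 := by
    simp [PiLp.inner_apply, Fin.sum_univ_two, mul_comm]
  have h4 : ‖a‖ ^ 2 = a 0 ^ 2 + a 1 ^ 2 := by
    simp [EuclideanSpace.norm_sq_eq, Fin.sum_univ_two]
  have h0 : a 0 = (a 0 * n 1 - a 1 * n 0) * n 1 := by linear_combination (-a 0) * h1 + n 0 * h2
  have h1' : a 1 = -(a 0 * n 1 - a 1 * n 0) * n 0 := by linear_combination (-a 1) * h1 + n 1 * h2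
  refine (sq_eq_sq₀ (by positivity) (abs_nonneg _)).1 ?_
  rw [mul_pow, sq_abs, sq_abs, h4, h3]
  set c := a 0 * n 1 - a 1 * n 0
  rw [h0, h1']
  linear_combination (c ^ 2 * (g 0 * n 0 + g 1 * n 1) ^ 2) * h1

/-- In an affine relation of the four vertices of a quadrilateral, the coefficients of two adjacent
vertices have opposite signs, because the opposite edge is exposed. -/
theorem IsCubeCell.exists_pos_mul_add_eq_zero {K : Set (E 2)} {v : (Fin 2 → Bool) → E 2}
    (hinj : Function.Injective v) (hK : K = convexHull ℝ (range v))
    (hext : extremePoints ℝ K = range v)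
    (hF : ∀ F : Set (E 2), IsFacet K F ↔
      ∃ (i : Fin 2) (b : Bool), F = convexHull ℝ (v '' {s | s i = b}))
    {c : (Fin 2 → Bool) → ℝ} (hc : ∑ s, c s = 0) (hcv : ∑ s, c s • v s = 0) (i : Fin 2) (b : Bool) :
    ∃ δ : (Fin 2 → Bool) → ℝ, (∀ s, s i ≠ b → 0 < δ s) ∧ (∀ s, s i = b → δ s = 0) ∧
      ∑ s, c s * δ s = 0 := by
  have hfac := (hF _).2 ⟨i, b, rfl⟩
  obtain ⟨a, -, ha⟩ := hfac.2.1.exists_inner hfac.1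
  obtain ⟨x, hx⟩ := hfac.1
  have hvK : ∀ s, v s ∈ K := fun s => by
    rw [hK]
    exact subset_convexHull ℝ _ ⟨s, rfl⟩
  have hx' := hx
  rw [ha] at hx'
  refine ⟨fun s => inner ℝ a x - inner ℝ a (v s), ?_, ?_, ?_⟩
  · intro s hs
    rw [sub_pos]
    refine lt_of_le_of_ne (hx'.2 _ (hvK s)) fun heq => hs ?_
    have hmem : v s ∈ convexHull ℝ (v '' {s | s i = b}) := by
      rw [ha]
      exact ⟨hvK s, fun y hy => heq ▸ hx'.2 y hy⟩
    have hse : v s ∈ extremePoints ℝ (convexHull ℝ (v '' {s | s i = b})) := by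
      rw [hfac.2.1.isExtreme.extremePoints_eq, hext]
      exact ⟨hmem, s, rfl⟩
    obtain ⟨s', hs', h⟩ := extremePoints_convexHull_subset hse
    rw [← hinj h]
    exact hs'
  · intro s hs
    have hmem : v s ∈ convexHull ℝ (v '' {s | s i = b}) := subset_convexHull ℝ _ ⟨s, hs, rfl⟩
    rw [ha] at hmem
    have h1 := hmem.2 x hx'.1
    have h2 := hx'.2 _ (hvK s)
    simp only
    linarith
  · have h : ∑ s, c s * inner ℝ a (v s) = 0 := by
      have : inner ℝ a (∑ s, c s • v s) = 0 := by rw [hcv, inner_zero_right]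
      simpa [inner_sum, inner_smul_right] using this
    simp_rw [mul_sub, Finset.sum_sub_distrib, h, ← Finset.sum_mul, hc]
    simp

/-- The total variation of four numbers along a cycle is at most twice their range, unless both
numbers at opposite places exceed the other two. -/
theorem cycle_variation_le {p q r s D : ℝ} (h1 : ¬ (q < p ∧ s < p ∧ q < r ∧ s < r))
    (h2 : ¬ (p < q ∧ p < s ∧ r < q ∧ r < s)) (hpq : |p - q| ≤ D) (hqr : |q - r| ≤ D)
    (hrs : |r - s| ≤ D) (hsp : |s - p| ≤ D) (hpr : |p - r| ≤ D) (hqs : |q - s| ≤ D) :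
    |p - q| + |q - r| + |r - s| + |s - p| ≤ 2 * D := by
  rw [abs_le] at *
  rcases abs_cases (p - q) with ⟨e1, f1⟩ | ⟨e1, f1⟩ <;>
  rcases abs_cases (q - r) with ⟨e2, f2⟩ | ⟨e2, f2⟩ <;>
  rcases abs_cases (r - s) with ⟨e3, f3⟩ | ⟨e3, f3⟩ <;>
  rcases abs_cases (s - p) with ⟨e4, f4⟩ | ⟨e4, f4⟩ <;>
  rw [e1, e2, e3, e4] <;> first
  | linarith
  | (by_contra hlt; exact h1 ⟨by linarith, by linarith, by linarith, by linarith⟩)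
  | (by_contra hlt; exact h2 ⟨by linarith, by linarith, by linarith, by linarith⟩)

theorem sum_fin_two_bool (f : (Fin 2 → Bool) → ℝ) : ∑ s, f s =
    f ![false, false] + f ![false, true] + f ![true, false] + f ![true, true] := by
  rw [← (finTwoArrowEquiv Bool).symm.sum_comp, Fintype.sum_prod_type]
  simp [finTwoArrowEquiv]
  ring

theorem neg_of_pos_of_mul_add_eq_zero {a b x y : ℝ} (ha : 0 < a) (hx : 0 < x) (hy : 0 < y)
    (h : a * x + b * y = 0) : b < 0 := by
  by_contra! hb
  nlinarith [mul_pos ha hx, mul_nonneg hb hy.le]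

/-- A balanced relation with signs `+`, `-`, `+`, `-` along a cycle excludes that both positive
places carry larger values than the negative ones. -/
theorem not_separated_of_relation {a b c e p q r s : ℝ} (ha : 0 < a) (hb : b < 0) (hc : 0 < c)
    (he : e < 0) (h0 : a + b + c + e = 0) (h1 : a * p + b * q + c * r + e * s = 0) :
    ¬ (q < p ∧ s < p ∧ q < r ∧ s < r) := by
  rintro ⟨hqp, hsp, hqr, hsr⟩
  rcases le_total q s with h | h
  · have h2 : a * (p - s) + b * (q - s) + c * (r - s) = 0 := by linear_combination h1 - s * h0
    nlinarith [mul_pos ha (sub_pos.2 hsp), mul_pos hc (sub_pos.2 hsr),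
      mul_nonneg (neg_nonneg.2 hb.le) (sub_nonneg.2 h)]
  · have h2 : a * (p - q) + c * (r - q) + e * (s - q) = 0 := by linear_combination h1 - q * h0
    nlinarith [mul_pos ha (sub_pos.2 hqp), mul_pos hc (sub_pos.2 hqr),
      mul_nonneg (neg_nonneg.2 he.le) (sub_nonneg.2 h)]

/-- The diagonals of a quadrilateral intersect: the affine relation of the four vertices has
positive coefficients on one diagonal and negative ones on the other. -/
theorem IsCubeCell.exists_relation {K : Set (E 2)} {v : (Fin 2 → Bool) → E 2}
    (hinj : Function.Injective v) (hK : K = convexHull ℝ (range v))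
    (hext : extremePoints ℝ K = range v)
    (hF : ∀ F : Set (E 2), IsFacet K F ↔
      ∃ (i : Fin 2) (b : Bool), F = convexHull ℝ (v '' {s | s i = b})) :
    ∃ c : (Fin 2 → Bool) → ℝ, ∑ s, c s = 0 ∧ ∑ s, c s • v s = 0 ∧
      0 < c ![false, false] ∧ c ![false, true] < 0 ∧ 0 < c ![true, true] ∧
      c ![true, false] < 0 := by
  have hdep : ¬ AffineIndependent ℝ v := by
    intro h
    have h1 := h.card_le_finrank_succ
    have h2 := (vectorSpan ℝ (range v)).finrank_le
    simp at h1 h2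
    omega
  obtain ⟨c, hc, hcv, s₀, hs₀⟩ : ∃ c : (Fin 2 → Bool) → ℝ, ∑ s, c s = 0 ∧ ∑ s, c s • v s = 0 ∧
      ∃ s, c s ≠ 0 := by
    rw [affineIndependent_iff] at hdep
    push Not at hdep
    obtain ⟨S, w, h1, h2, s, hs, h3⟩ := hdep
    refine ⟨fun s => if s ∈ S then w s else 0, ?_, ?_, s, by simpa [hs] using h3⟩
    · simpa using h1
    · simpa [ite_smul] using h2
  -- adjacent coefficients balance each other with positive weights
  have hadj : ∀ c : (Fin 2 → Bool) → ℝ, ∑ s, c s = 0 → ∑ s, c s • v s = 0 →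
      (∃ x y : ℝ, 0 < x ∧ 0 < y ∧ c ![false, false] * x + c ![false, true] * y = 0) ∧
      (∃ x y : ℝ, 0 < x ∧ 0 < y ∧ c ![true, false] * x + c ![true, true] * y = 0) ∧
      (∃ x y : ℝ, 0 < x ∧ 0 < y ∧ c ![false, false] * x + c ![true, false] * y = 0) := by
    intro c hc hcv
    obtain ⟨δ₁, hp₁, hz₁, h₁⟩ := exists_pos_mul_add_eq_zero hinj hK hext hF hc hcv 0 true
    obtain ⟨δ₂, hp₂, hz₂, h₂⟩ := exists_pos_mul_add_eq_zero hinj hK hext hF hc hcv 0 false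
    obtain ⟨δ₃, hp₃, hz₃, h₃⟩ := exists_pos_mul_add_eq_zero hinj hK hext hF hc hcv 1 true
    rw [sum_fin_two_bool] at h₁ h₂ h₃
    refine ⟨⟨_, _, hp₁ ![false, false] (by simp), hp₁ ![false, true] (by simp), ?_⟩,
      ⟨_, _, hp₂ ![true, false] (by simp), hp₂ ![true, true] (by simp), ?_⟩,
      ⟨_, _, hp₃ ![false, false] (by simp), hp₃ ![true, false] (by simp), ?_⟩⟩
    · rw [hz₁ ![true, false] (by simp), hz₁ ![true, true] (by simp)] at h₁
      linarith
    · rw [hz₂ ![false, false] (by simp), hz₂ ![false, true] (by simp)] at h₂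
      linarith
    · rw [hz₃ ![false, true] (by simp), hz₃ ![true, true] (by simp)] at h₃
      linarith
  have hsign : ∀ c : (Fin 2 → Bool) → ℝ, ∑ s, c s = 0 → ∑ s, c s • v s = 0 →
      0 < c ![false, false] → c ![false, true] < 0 ∧ 0 < c ![true, true] ∧
        c ![true, false] < 0 := by
    intro c hc hcv h0
    obtain ⟨⟨x₁, y₁, hx₁, hy₁, h₁⟩, ⟨x₂, y₂, hx₂, hy₂, h₂⟩, ⟨x₃, y₃, hx₃, hy₃, h₃⟩⟩ := hadj c hc hcv
    have h4 := neg_of_pos_of_mul_add_eq_zero h0 hx₃ hy₃ h₃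
    have h5 := neg_of_pos_of_mul_add_eq_zero (a := -c ![true, false]) (b := -c ![true, true])
      (by linarith) hx₂ hy₂ (by linarith)
    exact ⟨neg_of_pos_of_mul_add_eq_zero h0 hx₁ hy₁ h₁, by linarith, h4⟩
  have hne : c ![false, false] ≠ 0 := by
    intro h0
    obtain ⟨⟨x₁, y₁, hx₁, hy₁, h₁⟩, ⟨x₂, y₂, hx₂, hy₂, h₂⟩, ⟨x₃, y₃, hx₃, hy₃, h₃⟩⟩ := hadj c hc hcv
    have h4 : c ![false, true] = 0 := by simpa [h0, hy₁.ne'] using h₁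
    have h5 : c ![true, false] = 0 := by simpa [h0, hy₃.ne'] using h₃
    have h6 : c ![true, true] = 0 := by simpa [h5, hy₂.ne'] using h₂
    have h7 : ∑ s, c s ^ 2 = 0 := by
      rw [sum_fin_two_bool, h0, h4, h5, h6]
      norm_num
    rw [Finset.sum_eq_zero_iff_of_nonneg fun _ _ => sq_nonneg _] at h7
    exact hs₀ (by simpa using h7 s₀ (Finset.mem_univ _))
  rcases lt_or_gt_of_ne hne with h | h
  · have hc' : ∑ s, (-c) s = 0 := by simp [hc]
    have hcv' : ∑ s, (-c) s • v s = 0 := by simp [hcv]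
    have h' : 0 < (-c) ![false, false] := by simpa using h
    exact ⟨-c, hc', hcv', h', hsign (-c) hc' hcv' h'⟩
  · exact ⟨c, hc, hcv, h, hsign c hc hcv h⟩

theorem apply_fin_two_eq_iff : ∀ (q : Fin 2 × Bool) (s : Fin 2 → Bool), s q.1 = q.2 ↔
    s = (if q.1 = 0 then ![q.2, false] else ![false, q.2]) ∨
      s = (if q.1 = 0 then ![q.2, true] else ![true, q.2]) := by
  decide

/-- The sum over the edges of a quadrilateral `K`, with the edge lengths as weights, is bounded by
`‖g‖` times the variation along the boundary of `K` of a linear functional of norm `‖g‖`, and this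
variation is at most twice the oscillation of the functional on `K`. -/
theorem sum_diam_mul_inner_sq_quadrilateral_le {K : Set (E 2)} (hK : IsCubeCell K) {κ : Type*}
    {S : Finset κ} {φ : κ → Set (E 2)} (hφ : ∀ e ∈ S, IsFacet K (φ e))
    (hinj : InjOn φ S) {n : κ → E 2} (hn : ∀ e ∈ S, IsOutwardNormal K (φ e) (n e)) (g : E 2) :
    ∑ e ∈ S, Metric.diam (φ e) * inner ℝ g (n e) ^ 2 ≤ 2 * Metric.diam K * ‖g‖ ^ 2 := by
  classical
  obtain ⟨v, hvinj, hKv, -, hext, hF⟩ := hK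
  have hbdd : Bornology.IsBounded K := by
    rw [hKv]
    exact ((finite_range v).isCompact_convexHull ℝ).isBounded
  have hvK : ∀ s, v s ∈ K := fun s => by
    rw [hKv]
    exact subset_convexHull ℝ _ ⟨s, rfl⟩
  let ψ : E 2 → ℝ := fun x => g 0 * x 1 - g 1 * x 0
  have hosc : ∀ s s', |ψ (v s) - ψ (v s')| ≤ ‖g‖ * Metric.diam K := by
    intro s s'
    have h1 : ψ (v s) - ψ (v s') = inner ℝ !₂[-g 1, g 0] (v s - v s') := by
      simp [ψ, PiLp.inner_apply, Fin.sum_univ_two]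
      ring
    have h2 : ‖(!₂[-g 1, g 0] : E 2)‖ = ‖g‖ := by
      simp [EuclideanSpace.norm_eq, Fin.sum_univ_two, add_comm]
    rw [h1]
    refine (abs_real_inner_le_norm _ _).trans ?_
    rw [h2, ← dist_eq_norm]
    gcongr
    exact Metric.dist_le_diam_of_mem hbdd (hvK s) (hvK s')
  -- the end points of the edges
  let s₁ : Fin 2 × Bool → Fin 2 → Bool := fun q => if q.1 = 0 then ![q.2, false] else ![false, q.2]
  let s₂ : Fin 2 × Bool → Fin 2 → Bool := fun q => if q.1 = 0 then ![q.2, true] else ![true, q.2]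
  let W : Fin 2 × Bool → ℝ := fun q => |ψ (v (s₁ q)) - ψ (v (s₂ q))|
  have hpair : ∀ q : Fin 2 × Bool, {s : Fin 2 → Bool | s q.1 = q.2} = {s₁ q, s₂ q} := fun q => by
    ext s
    exact apply_fin_two_eq_iff q s
  have h : ∀ e : κ, ∃ q : Fin 2 × Bool, e ∈ S → φ e = convexHull ℝ {v (s₁ q), v (s₂ q)} := by
    intro e
    by_cases he : e ∈ S
    · obtain ⟨i, b, h⟩ := (hF _).1 (hφ e he)
      refine ⟨(i, b), fun _ => ?_⟩
      rw [h, hpair (i, b), image_pair]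
    · exact ⟨(0, true), fun h => absurd h he⟩
  choose q hq using h
  have hqinj : InjOn q S := fun e he e' he' heq =>
    hinj he he' (by rw [hq e he, hq e' he', heq])
  have hterm : ∀ e ∈ S, Metric.diam (φ e) * inner ℝ g (n e) ^ 2 ≤ ‖g‖ * W (q e) := by
    intro e he
    have hmem : ∀ x ∈ ({v (s₁ (q e)), v (s₂ (q e))} : Set (E 2)), x ∈ φ e := fun x hx => by
      rw [hq e he]
      exact subset_convexHull ℝ _ hx
    have hperp : inner ℝ (n e) (v (s₁ (q e)) - v (s₂ (q e))) = 0 :=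
      (Submodule.mem_orthogonal' _ _).1 ((hn e he).mem_orthogonal (hφ e he).subset) _
        (vsub_mem_vectorSpan ℝ (hmem _ (by simp)) (hmem _ (by simp)))
    have hd : Metric.diam (φ e) = ‖v (s₁ (q e)) - v (s₂ (q e))‖ := by
      rw [hq e he, convexHull_diam, Metric.diam_pair, dist_eq_norm]
    have hW : W (q e) = Metric.diam (φ e) * |inner ℝ g (n e)| := by
      rw [hd, norm_mul_abs_inner_normal (hn e he).1 hperp]
      simp only [W, ψ]
      congr 1
      simp
      ring
    have hg : |inner ℝ g (n e)| ≤ ‖g‖ := by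
      simpa [(hn e he).1] using abs_real_inner_le_norm g (n e)
    rw [hW, ← sq_abs]
    nlinarith [mul_nonneg (mul_nonneg (Metric.diam_nonneg (s := φ e))
      (abs_nonneg (inner ℝ g (n e)))) (sub_nonneg.2 hg)]
  obtain ⟨c, hc, hcv, h1, h2, h3, h4⟩ := IsCubeCell.exists_relation hvinj hKv hext hF
  have hψ : ∑ s, c s * ψ (v s) = 0 := by
    have e0 : ∑ s, c s * v s 0 = 0 := by simpa using congrArg (fun x : E 2 => x 0) hcv
    have e1 : ∑ s, c s * v s 1 = 0 := by simpa using congrArg (fun x : E 2 => x 1) hcv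
    calc ∑ s, c s * ψ (v s) = g 0 * ∑ s, c s * v s 1 - g 1 * ∑ s, c s * v s 0 := by
          rw [Finset.mul_sum, Finset.mul_sum, ← Finset.sum_sub_distrib]
          exact Finset.sum_congr rfl fun s _ => by simp only [ψ]; ring
      _ = 0 := by rw [e0, e1]; ring
  rw [sum_fin_two_bool] at hc hψ
  have hcycle := cycle_variation_le (p := ψ (v ![false, false])) (q := ψ (v ![false, true]))
    (r := ψ (v ![true, true])) (s := ψ (v ![true, false])) (D := ‖g‖ * Metric.diam K)
    (not_separated_of_relation h1 h2 h3 h4 (by linarith) (by linarith))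
    (fun hsep => not_separated_of_relation (a := -c ![false, true]) (b := -c ![false, false])
      (c := -c ![true, false]) (e := -c ![true, true]) (by linarith) (by linarith) (by linarith)
      (by linarith) (by linarith) (by linarith) ⟨hsep.1, hsep.2.2.1, hsep.2.1, hsep.2.2.2⟩)
    (hosc _ _) (hosc _ _) (hosc _ _) (hosc _ _) (hosc _ _) (hosc _ _)
  have hW : ∑ p, W p ≤ 2 * (‖g‖ * Metric.diam K) := by
    refine le_of_eq_of_le ?_ hcycle
    rw [Fintype.sum_prod_type]
    simp [W, s₁, s₂]
    rw [abs_sub_comm (ψ (v ![true, true])) (ψ (v ![true, false])),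
      abs_sub_comm (ψ (v ![false, false])) (ψ (v ![true, false]))]
    ring
  calc ∑ e ∈ S, Metric.diam (φ e) * inner ℝ g (n e) ^ 2 ≤ ∑ e ∈ S, ‖g‖ * W (q e) :=
        Finset.sum_le_sum hterm
    _ = ‖g‖ * ∑ p ∈ S.image q, W p := by rw [Finset.sum_image hqinj, Finset.mul_sum]
    _ ≤ ‖g‖ * ∑ p, W p := by
        gcongr
        exact Finset.subset_univ _
    _ ≤ ‖g‖ * (2 * (‖g‖ * Metric.diam K)) := by gcongr
    _ = _ := by ring

/-! ### The normal derivatives on the interior faces -/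

/-- A pointwise bound for the weighted sum over the facets of a quadrilateral or hexahedron, with
the factor `γ` of the mesh. -/
theorem DGMesh.sum_diam_mul_inner_sq_cube_le {d : ℕ} (hd : d = 2 ∨ d = 3) {ι : Type*} [Fintype ι]
    (M : DGMesh d ι) (hM : M.cell = .cube) (K : ι) {κ : Type*} {S : Finset κ}
    {φ : κ → Set (E d)} (hφ : ∀ e ∈ S, IsFacet (M.elem K) (φ e)) (hinj : InjOn φ S)
    {n : κ → E d} (hn : ∀ e ∈ S, IsOutwardNormal (M.elem K) (φ e) (n e)) (g : E d) :
    ∑ e ∈ S, Metric.diam (φ e) * inner ℝ g (n e) ^ 2 ≤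
      2 * M.shapeFactor * Metric.diam (M.elem K) * ‖g‖ ^ 2 := by
  have hcell := M.isCell K
  have hK : IsCubeCell (M.elem K) := by
    rw [hM] at hcell
    exact hcell
  have hle : ∑ e ∈ S, Metric.diam (φ e) * inner ℝ g (n e) ^ 2 ≤
      Metric.diam (M.elem K) * ∑ e ∈ S, inner ℝ g (n e) ^ 2 := by
    rw [Finset.mul_sum]
    refine Finset.sum_le_sum fun e he => ?_
    gcongr
    exact (hφ e he).diam_le hcell.isCompact
  rw [shapeFactor]
  split_ifs with h
  · rcases h with h | rfl | h
    · rw [hM] at h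
      cases h
    · rw [mul_one]
      exact sum_diam_mul_inner_sq_quadrilateral_le hK hφ hinj hn g
    · calc _ ≤ _ := hle
        _ ≤ Metric.diam (M.elem K) * (2 * ‖g‖ ^ 2) := by
            gcongr
            exact sum_inner_normal_sq_box_le (h K) hφ hinj hn g
        _ = _ := by ring
  · obtain rfl : d = 3 := by tauto
    have hcard : ((S.card : ℕ) : ℝ) ≤ 6 := by
      exact_mod_cast card_le_of_isFacet_cube hK hφ hinj
    have hterm : ∀ e ∈ S, inner ℝ g (n e) ^ 2 ≤ ‖g‖ ^ 2 := by
      intro e he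
      rw [sq_le_sq, abs_norm]
      simpa [(hn e he).1] using abs_real_inner_le_norm g (n e)
    calc _ ≤ _ := hle
      _ ≤ Metric.diam (M.elem K) * (S.card * ‖g‖ ^ 2) := by
          gcongr
          simpa using Finset.sum_le_card_nsmul S _ _ hterm
      _ ≤ Metric.diam (M.elem K) * (6 * ‖g‖ ^ 2) := by gcongr
      _ = _ := by ring

namespace DGMesh

variable {d : ℕ} {ι : Type*} [Fintype ι]

theorem shapeFactor_pos (M : DGMesh d ι) : 0 < M.shapeFactor := by
  rw [shapeFactor]
  split_ifs <;> norm_num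

theorem sum_integral_facets_le (hd : d = 2 ∨ d = 3) (M : DGMesh d ι) {C : ℝ}
    (hC : M.IsTraceConstant C) (K : ι) {κ : Type*} {S : Finset κ} {φ : κ → Set (E d)}
    (hφ : ∀ e ∈ S, IsFacet (M.elem K) (φ e)) (hinj : InjOn φ S) {n : κ → E d}
    (hn : ∀ e ∈ S, IsOutwardNormal (M.elem K) (φ e) (n e)) {p : E d → ℝ}
    (hp : p ∈ localSpace d M.cell) :
    ∑ e ∈ S, Metric.diam (φ e) * ∫ x in φ e, inner ℝ (gradient p x) (n e) ^ 2 ∂μHE[d - 1] ≤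
      2 * M.shapeFactor * C ^ 2 * ∫ x in M.elem K, ‖gradient p x‖ ^ 2 := by
  have hcell := M.isCell K
  have hKc := hcell.isCompact
  cases hM : M.cell with
  | simplex =>
    have h1 : M.shapeFactor = 1 := by simp [shapeFactor, hM]
    rw [h1, mul_one]
    exact sum_integral_facets_simplex_le hd M hM hC K hφ hinj (fun e he => (hn e he).1) hp
  | cube =>
    have hh : 0 < Metric.diam (M.elem K) := hcell.diam_pos (by omega)
    have hgc : Continuous (gradient p) := continuous_gradient (contDiff_of_mem_localSpace hp)
    have hint : ∀ e ∈ S, IntegrableOn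
        (fun x => Metric.diam (φ e) * inner ℝ (gradient p x) (n e) ^ 2) (M.elem K) := fun e _ =>
      integrableOn_of_continuous hKc hKc.measure_lt_top (by fun_prop)
    calc _ ≤ ∑ e ∈ S, Metric.diam (φ e) * (C ^ 2 * (Metric.diam (M.elem K))⁻¹ *
          ∫ x in M.elem K, inner ℝ (gradient p x) (n e) ^ 2) := by
          refine Finset.sum_le_sum fun e he => ?_
          gcongr
          refine hC.integral_sq_le (hφ e he) (p := fun x => inner ℝ (gradient p x) (n e)) ?_
          rw [hM] at hp ⊢
          exact inner_gradient_mem_localSpace_cube hp _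
      _ = C ^ 2 * (Metric.diam (M.elem K))⁻¹ * ∫ x in M.elem K,
          ∑ e ∈ S, Metric.diam (φ e) * inner ℝ (gradient p x) (n e) ^ 2 := by
          rw [integral_finsetSum _ hint, Finset.mul_sum]
          refine Finset.sum_congr rfl fun e _ => ?_
          rw [integral_const_mul]
          ring
      _ ≤ C ^ 2 * (Metric.diam (M.elem K))⁻¹ * ∫ x in M.elem K,
          2 * M.shapeFactor * Metric.diam (M.elem K) * ‖gradient p x‖ ^ 2 := by
          gcongr
          · exact integrable_finsetSum _ hint
          · exact integrableOn_of_continuous hKc hKc.measure_lt_top (by fun_prop)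
          · exact hKc.measurableSet.nullMeasurableSet
          · exact M.sum_diam_mul_inner_sq_cube_le hd hM K hφ hinj hn _
      _ = _ := by
          rw [integral_const_mul]
          field_simp

/-- The normal derivatives on all interior faces are controlled by the broken gradient. -/
theorem sum_integral_faces_le (hd : d = 2 ∨ d = 3) (M : DGMesh d ι) {C : ℝ}
    (hC : M.IsTraceConstant C) {w : ι → E d → ℝ} (hw : w ∈ M.X) :
    ∑ e ∈ M.faces, M.faceSize e *
      ((∫ x in M.face e, inner ℝ (gradient (w e.1) x) (M.normal e) ^ 2 ∂μHE[d - 1]) +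
        ∫ x in M.face e, inner ℝ (gradient (w e.2) x) (M.normal e) ^ 2 ∂μHE[d - 1]) ≤
      2 * M.shapeFactor * C ^ 2 * ∑ K, ∫ x in M.elem K, ‖gradient (w K) x‖ ^ 2 := by
  classical
  let a : ι × ι → ι → ℝ := fun e K => M.faceSize e *
    ∫ x in M.face e, inner ℝ (gradient (w K) x) (M.normal e) ^ 2 ∂μHE[d - 1]
  have hsplit : ∀ K, ∑ e ∈ M.faces with (e.1 = K ∨ e.2 = K), a e K =
      (∑ e ∈ M.faces with e.1 = K, a e e.1) + ∑ e ∈ M.faces with e.2 = K, a e e.2 := by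
    intro K
    rw [Finset.filter_or, Finset.sum_union]
    · congr 1 <;> refine Finset.sum_congr rfl fun e he => ?_ <;> rw [(Finset.mem_filter.1 he).2]
    · rw [Finset.disjoint_filter]
      intro e he h1 h2
      exact (M.faces_facet e he).1 (h1.trans h2.symm)
  have hK : ∀ K, ∑ e ∈ M.faces with (e.1 = K ∨ e.2 = K), a e K ≤
      2 * M.shapeFactor * C ^ 2 * ∫ x in M.elem K, ‖gradient (w K) x‖ ^ 2 := by
    intro K
    have h := M.sum_integral_facets_le hd hC K (S := {e ∈ M.faces | e.1 = K ∨ e.2 = K})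
      (φ := M.face) (n := fun e => if e.1 = K then M.normal e else -M.normal e)
      (by
        intro e he
        obtain ⟨he', rfl | rfl⟩ := Finset.mem_filter.1 he
        · exact M.isFacet_fst he'
        · exact M.isFacet_snd he')
      (by simpa using M.injOn_face K)
      (by
        intro e he
        obtain ⟨he', h⟩ := Finset.mem_filter.1 he
        split_ifs with h1
        · subst h1
          exact M.isOutwardNormal_fst he'
        · obtain rfl := h.resolve_left h1
          exact M.isOutwardNormal_snd he')
      (M.mem_localSpace hw K)
    refine le_of_eq_of_le (Finset.sum_congr rfl fun e _ => ?_) h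
    simp only [a, faceSize]
    congr 2
    ext x
    split_ifs <;> simp
  calc _ = ∑ e ∈ M.faces, a e e.1 + ∑ e ∈ M.faces, a e e.2 := by
        rw [← Finset.sum_add_distrib]
        exact Finset.sum_congr rfl fun e _ => mul_add _ _ _
    _ = ∑ K, ∑ e ∈ M.faces with (e.1 = K ∨ e.2 = K), a e K := by
        simp_rw [hsplit]
        rw [Finset.sum_add_distrib, Finset.sum_fiberwise M.faces Prod.fst (fun e => a e e.1),
          Finset.sum_fiberwise M.faces Prod.snd (fun e => a e e.2)]
    _ ≤ _ := by
        rw [Finset.mul_sum]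
        exact Finset.sum_le_sum fun K _ => hK K

end DGMesh

/-! ### Linear forms given by integrals -/

/-- `Φ` is linear on the subspace `V`. -/
def IsLinearOn {A : Type*} [AddCommGroup A] [Module ℝ A] (V : Submodule ℝ A) (Φ : A → ℝ) : Prop :=
  ∃ L : V →ₗ[ℝ] ℝ, ∀ v : V, Φ v = L v

namespace IsLinearOn

variable {A : Type*} [AddCommGroup A] [Module ℝ A] {V : Submodule ℝ A} {Φ Ψ : A → ℝ}

theorem add (hΦ : IsLinearOn V Φ) (hΨ : IsLinearOn V Ψ) : IsLinearOn V fun v => Φ v + Ψ v := by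
  obtain ⟨L, hL⟩ := hΦ
  obtain ⟨L', hL'⟩ := hΨ
  exact ⟨L + L', fun v => by simp [hL, hL']⟩

theorem const_mul (hΦ : IsLinearOn V Φ) (c : ℝ) : IsLinearOn V fun v => c * Φ v := by
  obtain ⟨L, hL⟩ := hΦ
  exact ⟨c • L, fun v => by simp [hL]⟩

theorem sub (hΦ : IsLinearOn V Φ) (hΨ : IsLinearOn V Ψ) : IsLinearOn V fun v => Φ v - Ψ v := by
  obtain ⟨L, hL⟩ := hΦ
  obtain ⟨L', hL'⟩ := hΨ
  exact ⟨L - L', fun v => by simp [hL, hL']⟩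

theorem sum {κ : Type*} {s : Finset κ} {Φ : κ → A → ℝ} (h : ∀ k ∈ s, IsLinearOn V (Φ k)) :
    IsLinearOn V fun v => ∑ k ∈ s, Φ k v := by
  classical
  induction s using Finset.induction_on with
  | empty => exact ⟨0, fun v => by simp⟩
  | insert k s hk ih =>
    simp_rw [Finset.sum_insert hk]
    exact (h k (Finset.mem_insert_self k s)).add
      (ih fun j hj => h j (Finset.mem_insert_of_mem hj))

theorem integral {α : Type*} [MeasurableSpace α] {μ : Measure α} {F : A → α → ℝ}
    (hint : ∀ v ∈ V, Integrable (F v) μ)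
    (hadd : ∀ u ∈ V, ∀ v ∈ V, ∀ x, F (u + v) x = F u x + F v x)
    (hsmul : ∀ (c : ℝ), ∀ u ∈ V, ∀ x, F (c • u) x = c * F u x) :
    IsLinearOn V fun v => ∫ x, F v x ∂μ := by
  refine ⟨{ toFun := fun v => ∫ x, F v x ∂μ
            map_add' := fun u v => ?_
            map_smul' := fun c u => ?_ }, fun v => rfl⟩
  · rw [← integral_add (hint u u.2) (hint v v.2)]
    exact integral_congr_ae (Filter.Eventually.of_forall (hadd u u.2 v v.2))
  · rw [RingHom.id_apply, smul_eq_mul, ← integral_const_mul]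
    exact integral_congr_ae (Filter.Eventually.of_forall (hsmul c u u.2))

theorem mono {W : Submodule ℝ A} (h : IsLinearOn W Φ) (hVW : V ≤ W) : IsLinearOn V Φ := by
  obtain ⟨L, hL⟩ := h
  exact ⟨L ∘ₗ Submodule.inclusion hVW, fun v => hL (Submodule.inclusion hVW v)⟩

theorem map_add (h : IsLinearOn V Φ) {u v : A} (hu : u ∈ V) (hv : v ∈ V) :
    Φ (u + v) = Φ u + Φ v := by
  obtain ⟨L, hL⟩ := h
  have := hL (⟨u, hu⟩ + ⟨v, hv⟩)
  rw [_root_.map_add, ← hL, ← hL] at this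
  exact this

end IsLinearOn

/-- A definite bilinear form on a finite-dimensional space represents every linear form. -/
theorem existsUnique_of_definite {A : Type*} [AddCommGroup A] [Module ℝ A] {V : Submodule ℝ A}
    [FiniteDimensional ℝ V] {b : A → A → ℝ} {f : A → ℝ}
    (hl : ∀ w ∈ V, IsLinearOn V fun u => b u w) (hr : ∀ u ∈ V, IsLinearOn V (b u))
    (hf : IsLinearOn V f) (hdef : ∀ u ∈ V, b u u = 0 → u = 0) :
    ∃! u, u ∈ V ∧ ∀ w ∈ V, b u w = f w := by
  have hl' : ∀ w : V, ∃ L : V →ₗ[ℝ] ℝ, ∀ u : V, b u w = L u := fun w => hl w w.2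
  have hr' : ∀ u : V, ∃ L : V →ₗ[ℝ] ℝ, ∀ w : V, b u w = L w := fun u => hr u u.2
  choose Ll hLl using hl'
  choose Lr hLr using hr'
  let B : V →ₗ[ℝ] V →ₗ[ℝ] ℝ :=
    { toFun := Lr
      map_add' := fun u v => by
        ext w
        rw [LinearMap.add_apply, ← hLr, ← hLr, ← hLr, hLl, hLl, hLl, map_add]
      map_smul' := fun c u => by
        ext w
        rw [RingHom.id_apply, LinearMap.smul_apply, ← hLr, ← hLr, hLl, hLl, map_smul] }
  have hB : ∀ u w : V, B u w = b u w := fun u w => (hLr u w).symm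
  have hinj : Function.Injective B := by
    rw [← LinearMap.ker_eq_bot, LinearMap.ker_eq_bot']
    intro u hu
    refine Subtype.ext (hdef u u.2 ?_)
    rw [← hB, hu]
    rfl
  have hsurj : Function.Surjective B :=
    (LinearMap.injective_iff_surjective_of_finrank_eq_finrank
      (Subspace.dual_finrank_eq (K := ℝ) (V := V)).symm).1 hinj
  obtain ⟨L, hL⟩ := hf
  obtain ⟨u, hu⟩ := hsurj L
  refine ⟨u, ⟨u.2, fun w hw => ?_⟩, ?_⟩
  · rw [← hB u ⟨w, hw⟩, hu, ← hL]
  · rintro v ⟨hv, hvw⟩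
    have : (⟨v, hv⟩ : V) = u := by
      apply hinj
      ext w
      rw [hB, hu, ← hL]
      exact hvw w w.2
    exact congrArg Subtype.val this

/-! ### The discrete pressure equation -/

theorem weightedAvg_eq {A₁ A₂ : ℝ} (h₁ : 0 < A₁) (h₂ : 0 < A₂) (z₁ z₂ : ℝ) :
    weightedAvg A₁ A₂ z₁ z₂ = harmonicAvg A₁ A₂ * ((z₁ + z₂) / 2) := by
  have : A₁ + A₂ ≠ 0 := by positivity
  rw [weightedAvg, harmonicAvg]
  field_simp

theorem harmonicAvg_mem_Icc {a c A₁ A₂ : ℝ} (hc : 0 < c) (h₁ : A₁ ∈ Icc c a) (h₂ : A₂ ∈ Icc c a) :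
    harmonicAvg A₁ A₂ ∈ Icc c a := by
  obtain ⟨h1, h2⟩ := h₁
  obtain ⟨h3, h4⟩ := h₂
  have h5 : 0 < A₁ + A₂ := by linarith
  rw [harmonicAvg]
  constructor
  · rw [le_div_iff₀ h5]
    nlinarith [mul_nonneg (sub_nonneg.2 h1) (by linarith : 0 ≤ A₂),
      mul_nonneg (sub_nonneg.2 h3) (by linarith : 0 ≤ A₁)]
  · rw [div_le_iff₀ h5]
    nlinarith [mul_nonneg (sub_nonneg.2 h2) (by linarith : 0 ≤ A₂),
      mul_nonneg (sub_nonneg.2 h4) (by linarith : 0 ≤ A₁)]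

namespace PressureData

variable {d : ℕ} {ι : Type*} {D : PressureData d ι}

/-- `f` is an admissible mobility: after multiplication with the permeability and evaluation at the
old time step it is a continuous positive function on each element. -/
def IsAdmissible (D : PressureData d ι) (f : ℝ → ℝ → ℝ → ℝ) : Prop :=
  ∀ K, Continuous (D.coef f K) ∧ ∀ x, 0 < D.coef f K x

theorem continuous_harmonicAvg {f : ℝ → ℝ → ℝ → ℝ} (hf : D.IsAdmissible f) (K K' : ι) :
    Continuous fun x => harmonicAvg (D.coef f K x) (D.coef f K' x) := by
  have h1 := (hf K).1
  have h2 := (hf K').1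
  unfold harmonicAvg
  refine Continuous.div (by fun_prop) (by fun_prop) fun x => ?_
  have := (hf K).2 x
  have := (hf K').2 x
  positivity

variable [Fintype ι] {M : DGMesh d ι}

theorem isAdmissible (hP : D.P ∈ M.X) (hSv : D.Sv ∈ M.X) (hSa : D.Sa ∈ M.X)
    (hκ : ∀ K, 0 < D.κ K) {f : ℝ → ℝ → ℝ → ℝ}
    (hf : Continuous fun z : ℝ × ℝ × ℝ => f z.1 z.2.1 z.2.2) (hpos : ∀ p sv sa, 0 < f p sv sa) :
    D.IsAdmissible f := by
  intro K
  refine ⟨?_, fun x => mul_pos (hκ K) (hpos _ _ _)⟩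
  have h1 := continuous_of_mem_localSpace (M.mem_localSpace hP K)
  have h2 := continuous_of_mem_localSpace (M.mem_localSpace hSv K)
  have h3 := continuous_of_mem_localSpace (M.mem_localSpace hSa K)
  exact continuous_const.mul (hf.comp (h1.prodMk (h2.prodMk h3)))

theorem fluxAvg_eq {f : ℝ → ℝ → ℝ → ℝ} (hf : D.IsAdmissible f) (G : ι → E d → E d) (e : ι × ι)
    (x : E d) : D.fluxAvg M f G e x = harmonicAvg (D.coef f e.1 x) (D.coef f e.2 x) *
      ((inner ℝ (G e.1 x) (M.normal e) + inner ℝ (G e.2 x) (M.normal e)) / 2) :=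
  weightedAvg_eq ((hf _).2 x) ((hf _).2 x) _ _

theorem continuous_fluxAvg {f : ℝ → ℝ → ℝ → ℝ} (hf : D.IsAdmissible f) {G : ι → E d → E d}
    (hG : ∀ K, Continuous (G K)) (e : ι × ι) : Continuous (D.fluxAvg M f G e) := by
  have h0 := continuous_harmonicAvg hf e.1 e.2
  have h1 := hG e.1
  have h2 := hG e.2
  simp_rw [funext (fluxAvg_eq hf G e)]
  fun_prop

theorem continuous_brokenGrad {w : ι → E d → ℝ} (hw : w ∈ M.X) (K : ι) :
    Continuous (brokenGrad w K) :=
  continuous_gradient (contDiff_of_mem_localSpace (M.mem_localSpace hw K))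

theorem brokenGrad_add {u v : ι → E d → ℝ} (hu : u ∈ M.X) (hv : v ∈ M.X) (K : ι) (x : E d) :
    brokenGrad (u + v) K x = brokenGrad u K x + brokenGrad v K x :=
  gradient_add (differentiable_of_mem_localSpace (M.mem_localSpace hu K))
    (differentiable_of_mem_localSpace (M.mem_localSpace hv K)) x

theorem brokenGrad_smul {u : ι → E d → ℝ} (hu : u ∈ M.X) (c : ℝ) (K : ι) (x : E d) :
    brokenGrad (c • u) K x = c • brokenGrad u K x :=
  gradient_smul (differentiable_of_mem_localSpace (M.mem_localSpace hu K)) c x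

theorem continuous_jump {w : ι → E d → ℝ} (hw : w ∈ M.X) (e : ι × ι) :
    Continuous (M.jump w e) :=
  (continuous_of_mem_localSpace (M.mem_localSpace hw _)).sub
    (continuous_of_mem_localSpace (M.mem_localSpace hw _))

theorem jump_add (u v : ι → E d → ℝ) (e : ι × ι) (x : E d) :
    M.jump (u + v) e x = M.jump u e x + M.jump v e x := by
  simp only [DGMesh.jump, Pi.add_apply]
  ring

theorem jump_smul (c : ℝ) (u : ι → E d → ℝ) (e : ι × ι) (x : E d) :
    M.jump (c • u) e x = c * M.jump u e x := by
  simp only [DGMesh.jump, Pi.smul_apply, smul_eq_mul]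
  ring

theorem integrableOn_elem (M : DGMesh d ι) (K : ι) {g : E d → ℝ} (hg : Continuous g) :
    IntegrableOn g (M.elem K) :=
  integrableOn_of_continuous (M.isCell K).isCompact (M.isCell K).isCompact.measure_lt_top hg

theorem integrableOn_face (M : DGMesh d ι) {e : ι × ι} (he : e ∈ M.faces) {g : E d → ℝ}
    (hg : Continuous g) : IntegrableOn g (M.face e) μHE[d - 1] :=
  (M.isFacet_fst he).integrableOn (M.isCell _).isCompact hg

/-- The face terms that test with a jump. -/
theorem isLinearOn_integral_mul_jump {e : ι × ι} (he : e ∈ M.faces) {g : E d → ℝ}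
    (hg : Continuous g) :
    IsLinearOn M.X fun w => ∫ x in M.face e, g x * M.jump w e x ∂μHE[d - 1] := by
  refine IsLinearOn.integral (fun w hw => integrableOn_face M he (hg.mul (continuous_jump hw e)))
    (fun u _ v _ x => ?_) (fun c u _ x => ?_)
  · rw [jump_add]
    ring
  · rw [jump_smul]
    ring

/-- The face terms that test with a flux. -/
theorem isLinearOn_integral_fluxAvg_mul {f : ℝ → ℝ → ℝ → ℝ} (hf : D.IsAdmissible f) {e : ι × ι}
    (he : e ∈ M.faces) {g : E d → ℝ} (hg : Continuous g) :
    IsLinearOn M.X fun w => ∫ x in M.face e, D.fluxAvg M f (brokenGrad w) e x * g x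
      ∂μHE[d - 1] := by
  refine IsLinearOn.integral (fun w hw => integrableOn_face M he
    ((continuous_fluxAvg hf (continuous_brokenGrad hw) e).mul hg))
    (fun u hu v hv x => ?_) (fun c u hu x => ?_)
  · simp only [fluxAvg_eq hf, brokenGrad_add hu hv, inner_add_left]
    ring
  · simp only [fluxAvg_eq hf, brokenGrad_smul hu, inner_smul_left, conj_trivial]
    ring

/-- The element terms that test with a gradient. -/
theorem isLinearOn_integral_inner {G : E d → E d} (hG : Continuous G) (K : ι) :
    IsLinearOn M.X fun w => ∫ x in M.elem K, inner ℝ (G x) (brokenGrad w K x) := by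
  refine IsLinearOn.integral (fun w hw => integrableOn_elem M K
    (hG.inner (continuous_brokenGrad hw K))) (fun u hu v hv x => ?_) (fun c u hu x => ?_)
  · rw [brokenGrad_add hu hv, inner_add_right]
  · rw [brokenGrad_smul hu, inner_smul_right]

theorem isLinearOn_b_right (hT : D.IsAdmissible D.lamT) {u : ι → E d → ℝ} (hu : u ∈ M.X) :
    IsLinearOn M.X (D.b M u) := by
  refine IsLinearOn.add (IsLinearOn.sub (IsLinearOn.add ?_ ?_) ?_) ?_
  · refine IsLinearOn.sum fun K _ => ?_
    simp_rw [← real_inner_smul_left]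
    exact isLinearOn_integral_inner ((hT K).1.smul (continuous_brokenGrad hu K)) K
  · refine IsLinearOn.sum fun e he => IsLinearOn.const_mul ?_ _
    exact isLinearOn_integral_mul_jump he
      ((continuous_harmonicAvg hT _ _).mul (continuous_jump hu e))
  · exact IsLinearOn.sum fun e he => isLinearOn_integral_mul_jump he
      (continuous_fluxAvg hT (continuous_brokenGrad hu) e)
  · refine IsLinearOn.const_mul (IsLinearOn.sum fun e he => ?_) _
    exact isLinearOn_integral_fluxAvg_mul hT he (continuous_jump hu e)

theorem isLinearOn_b_left (hT : D.IsAdmissible D.lamT) {w : ι → E d → ℝ} (hw : w ∈ M.X) :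
    IsLinearOn M.X fun u => D.b M u w := by
  refine IsLinearOn.add (IsLinearOn.sub (IsLinearOn.add ?_ ?_) ?_) ?_
  · refine IsLinearOn.sum fun K _ => ?_
    have h : ∀ (u : ι → E d → ℝ) x,
        D.coef D.lamT K x * inner ℝ (brokenGrad u K x) (brokenGrad w K x) =
          inner ℝ (D.coef D.lamT K x • brokenGrad w K x) (brokenGrad u K x) := fun u x => by
      rw [real_inner_smul_left, real_inner_comm]
    simp_rw [h]
    exact isLinearOn_integral_inner ((hT K).1.smul (continuous_brokenGrad hw K)) K
  · refine IsLinearOn.sum fun e he => IsLinearOn.const_mul ?_ _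
    have h : ∀ (u : ι → E d → ℝ) x,
        harmonicAvg (D.coef D.lamT e.1 x) (D.coef D.lamT e.2 x) * M.jump u e x * M.jump w e x =
          harmonicAvg (D.coef D.lamT e.1 x) (D.coef D.lamT e.2 x) * M.jump w e x * M.jump u e x :=
      fun u x => mul_right_comm _ _ _
    simp_rw [h]
    exact isLinearOn_integral_mul_jump he
      ((continuous_harmonicAvg hT _ _).mul (continuous_jump hw e))
  · refine IsLinearOn.sum fun e he => ?_
    exact isLinearOn_integral_fluxAvg_mul hT he (continuous_jump hw e)
  · refine IsLinearOn.const_mul (IsLinearOn.sum fun e he => ?_) _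
    exact isLinearOn_integral_mul_jump he (continuous_fluxAvg hT (continuous_brokenGrad hw) e)

/-- A function that is integrable on a compact set stays so after multiplication with a local
polynomial. -/
theorem isLinearOn_integral_mul {μ : Measure (E d)} {F : Set (E d)} (hF : IsCompact F)
    {g : E d → ℝ} (hg : IntegrableOn g F μ) (K : ι) :
    IsLinearOn M.X fun w => ∫ x in F, g x * w K x ∂μ := by
  refine IsLinearOn.integral (fun w hw => ?_) (fun u _ v _ x => ?_) (fun c u _ x => ?_)
  · exact hg.mul_continuousOn (continuous_of_mem_localSpace (M.mem_localSpace hw K)).continuousOn hF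
  · simp only [Pi.add_apply]
    ring
  · simp only [Pi.smul_apply, smul_eq_mul]
    ring

theorem continuous_brokenGrad_comp {φ : ℝ → ℝ} (hφ : ContDiff ℝ 1 φ) {S : ι → E d → ℝ}
    (hS : S ∈ M.X) (K : ι) : Continuous (brokenGrad (fun K x => φ (S K x)) K) :=
  continuous_gradient (hφ.comp (contDiff_of_mem_localSpace (M.mem_localSpace hS K)))

theorem integrableOn_of_memLp_domain {q : E d → ℝ} (hq : MemLp q ⊤ (volume.restrict M.domain))
    (K : ι) : IntegrableOn q (M.elem K) := by
  have hc := M.isCell K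
  have h1 : volume.restrict (M.elem K) = volume.restrict (interior (M.elem K)) := by
    refine (Measure.restrict_congr_set ?_).symm
    exact interior_ae_eq_of_null_frontier (hc.convex.addHaar_frontier volume)
  have hfin : IsFiniteMeasure (volume.restrict (M.elem K)) :=
    ⟨by simpa using hc.isCompact.measure_lt_top⟩
  rw [IntegrableOn, ← memLp_one_iff_integrable]
  refine MemLp.mono_exponent (q := ⊤) ?_ le_top
  rw [h1]
  exact hq.mono_measure (Measure.restrict_mono_set _ (M.interior_elem_subset_domain K))

theorem isLinearOn_f (hV : D.IsAdmissible D.lamV) (hA : D.IsAdmissible D.lamA)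
    (hρ : D.IsAdmissible D.rhoLamT) (hSv : D.Sv ∈ M.X) (hSa : D.Sa ∈ M.X)
    (hpcv : ContDiff ℝ 1 D.pcv) (hpca : ContDiff ℝ 1 D.pca)
    (hqL : MemLp D.qL ⊤ (volume.restrict M.domain))
    (hqV : MemLp D.qV ⊤ (volume.restrict M.domain))
    (hqA : MemLp D.qA ⊤ (volume.restrict M.domain))
    {ΓN : Finset (ι × Set (E d))} (hΓN : ∀ p ∈ ΓN, IsCompact p.2)
    (hjN : ∀ p ∈ ΓN, IntegrableOn D.jN p.2 μHE[d - 1]) :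
    IsLinearOn M.X (D.f M ΓN) := by
  have hcv : ∀ K, Continuous (D.gradPcv K) := continuous_brokenGrad_comp hpcv hSv
  have hca : ∀ K, Continuous (D.gradPca K) := continuous_brokenGrad_comp hpca hSa
  refine IsLinearOn.sub (IsLinearOn.sub (IsLinearOn.add (IsLinearOn.sub (IsLinearOn.add
    ?_ ?_) ?_) ?_) ?_) ?_
  · refine IsLinearOn.sum fun K _ => isLinearOn_integral_mul (M.isCell K).isCompact ?_ K
    exact ((integrableOn_of_memLp_domain hqL K).add (integrableOn_of_memLp_domain hqV K)).add
      (integrableOn_of_memLp_domain hqA K)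
  · exact IsLinearOn.sum fun p hp => isLinearOn_integral_mul (hΓN p hp) (hjN p hp) p.1
  · refine IsLinearOn.sum fun K _ => isLinearOn_integral_inner ?_ K
    exact (((hV K).1.smul (hcv K)).sub ((hA K).1.smul (hca K))).sub
      ((hρ K).1.smul continuous_const)
  · exact IsLinearOn.sum fun e he => isLinearOn_integral_mul_jump he (continuous_fluxAvg hV hcv e)
  · exact IsLinearOn.sum fun e he => isLinearOn_integral_mul_jump he (continuous_fluxAvg hA hca e)
  · exact IsLinearOn.sum fun e he => isLinearOn_integral_mul_jump he
      (continuous_fluxAvg hρ (fun _ => continuous_const) e)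

end PressureData

/-! ### Coercivity -/

/-- Young's inequality with the weight `β / h`. -/
theorem young_flux {s m j β h : ℝ} (hβ : 0 < β) (hh : 0 < h) :
    s * m * j ≤ β * h⁻¹ * j ^ 2 + s ^ 2 / (4 * β) * h * m ^ 2 := by
  have : β * h⁻¹ * j ^ 2 + s ^ 2 / (4 * β) * h * m ^ 2 - s * m * j =
      β * h⁻¹ * (j - s * h * m / (2 * β)) ^ 2 := by
    field_simp
    ring
  have h2 : 0 ≤ β * h⁻¹ * (j - s * h * m / (2 * β)) ^ 2 := by positivity
  linarith

namespace PressureData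

variable {d : ℕ} {ι : Type*} [Fintype ι] {D : PressureData d ι} {M : DGMesh d ι}

/-- On a single interior face the penalty term absorbs the consistency terms, up to the normal
derivatives of the two neighbours. -/
theorem integral_face_terms_ge (hT : D.IsAdmissible D.lamT) {a c : ℝ} (hc : 0 < c)
    (hac : ∀ K x, D.coef D.lamT K x ∈ Icc c a) {w : ι → E d → ℝ} (hw : w ∈ M.X)
    {e : ι × ι} (he : e ∈ M.faces) (hh : 0 < M.faceSize e) {αLow β : ℝ} (hα : αLow ≤ D.α e)
    (hβ : 0 < β) (hβα : β < αLow) :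
    (αLow - β) * c * (M.faceSize e)⁻¹ * (∫ x in M.face e, M.jump w e x ^ 2 ∂μHE[d - 1])
      - (1 - D.θ) ^ 2 * a / (8 * β) * (M.faceSize e *
        ((∫ x in M.face e, inner ℝ (gradient (w e.1) x) (M.normal e) ^ 2 ∂μHE[d - 1]) +
          ∫ x in M.face e, inner ℝ (gradient (w e.2) x) (M.normal e) ^ 2 ∂μHE[d - 1])) ≤
    D.α e * (M.faceSize e)⁻¹ *
        (∫ x in M.face e, harmonicAvg (D.coef D.lamT e.1 x) (D.coef D.lamT e.2 x) *
          M.jump w e x * M.jump w e x ∂μHE[d - 1])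
      - (1 - D.θ) * ∫ x in M.face e, D.fluxAvg M D.lamT (brokenGrad w) e x * M.jump w e x
        ∂μHE[d - 1] := by
  set h := M.faceSize e
  have hjc := continuous_jump hw e
  have hηc := continuous_harmonicAvg hT e.1 e.2
  have hfc := continuous_fluxAvg (M := M) hT (continuous_brokenGrad hw) e
  have hg1 : Continuous (gradient (w e.1)) := continuous_brokenGrad hw e.1
  have hg2 : Continuous (gradient (w e.2)) := continuous_brokenGrad hw e.2
  have hI : ∀ {g : E d → ℝ}, Continuous g → IntegrableOn g (M.face e) μHE[d - 1] :=
    fun hg => integrableOn_face M he hg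
  rw [← integral_const_mul (D.α e * h⁻¹), ← integral_const_mul (1 - D.θ),
    ← integral_sub (hI (by fun_prop)) (hI (by fun_prop)),
    ← integral_add (hI (by fun_prop)) (hI (by fun_prop)), ← integral_const_mul h,
    ← integral_const_mul, ← integral_const_mul,
    ← integral_sub (hI (by fun_prop)) (hI (by fun_prop))]
  refine integral_mono (hI (by fun_prop)) (hI (by fun_prop)) fun x => ?_
  obtain ⟨hη1, hη2⟩ := harmonicAvg_mem_Icc hc (hac e.1 x) (hac e.2 x)
  simp only [fluxAvg_eq hT, brokenGrad]
  set η := harmonicAvg (D.coef D.lamT e.1 x) (D.coef D.lamT e.2 x)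
  set j := M.jump w e x
  set z₁ := inner ℝ (gradient (w e.1) x) (M.normal e)
  set z₂ := inner ℝ (gradient (w e.2) x) (M.normal e)
  have hη0 : 0 < η := hc.trans_le hη1
  have hy := mul_le_mul_of_nonneg_left (young_flux (s := 1 - D.θ) (m := (z₁ + z₂) / 2) (j := j)
    hβ hh) hη0.le
  have hz : ((z₁ + z₂) / 2) ^ 2 ≤ (z₁ ^ 2 + z₂ ^ 2) / 2 := by nlinarith [sq_nonneg (z₁ - z₂)]
  have h1 : η * ((1 - D.θ) ^ 2 / (4 * β) * h * ((z₁ + z₂) / 2) ^ 2) ≤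
      a * ((1 - D.θ) ^ 2 / (4 * β) * h * ((z₁ ^ 2 + z₂ ^ 2) / 2)) := by
    have : 0 ≤ (1 - D.θ) ^ 2 / (4 * β) * h * ((z₁ ^ 2 + z₂ ^ 2) / 2) := by positivity
    calc _ ≤ η * ((1 - D.θ) ^ 2 / (4 * β) * h * ((z₁ ^ 2 + z₂ ^ 2) / 2)) := by gcongr
      _ ≤ _ := by gcongr
  have h2 : (αLow - β) * c * h⁻¹ * j ^ 2 ≤ (D.α e - β) * η * h⁻¹ * j ^ 2 := by
    have : 0 ≤ αLow - β := by linarith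
    have : 0 ≤ D.α e - β := by linarith
    gcongr
  have h3 : (1 - D.θ) ^ 2 * a / (8 * β) * (h * (z₁ ^ 2 + z₂ ^ 2)) =
      a * ((1 - D.θ) ^ 2 / (4 * β) * h * ((z₁ ^ 2 + z₂ ^ 2) / 2)) := by
    field_simp
    ring
  rw [h3]
  linarith

/-- The broken gradient and the jumps are controlled by the energy, if the penalty exceeds
the threshold. -/
theorem exists_coercivity (hd : d = 2 ∨ d = 3) (hT : D.IsAdmissible D.lamT) {a c : ℝ} (hc : 0 < c)
    (hac : ∀ K x, D.coef D.lamT K x ∈ Icc c a) (hca : c ≤ a) {C : ℝ} (hC : M.IsTraceConstant C)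
    {αLow : ℝ} (hα : ∀ e ∈ M.faces, αLow ≤ D.α e)
    (hthr : M.shapeFactor * (1 / 4) * (1 - D.θ) ^ 2 * a ^ 3 / c ^ 3 * C ^ 2 < αLow) :
    ∃ δ ε : ℝ, 0 < δ ∧ 0 < ε ∧ ∀ w ∈ M.X,
      δ * (∑ K, ∫ x in M.elem K, ‖gradient (w K) x‖ ^ 2) +
        ε * (∑ e ∈ M.faces, (M.faceSize e)⁻¹ *
          ∫ x in M.face e, M.jump w e x ^ 2 ∂μHE[d - 1]) ≤ D.b M w w := by
  have ha : 0 < a := hc.trans_le hca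
  have hγ := M.shapeFactor_pos
  set T := M.shapeFactor * (1 / 4) * (1 - D.θ) ^ 2 * a ^ 3 / c ^ 3 * C ^ 2 with hTdef
  have hT0 : 0 ≤ T := by positivity
  -- any weight strictly between the threshold and the penalty works in Young's inequality
  set β := (T + αLow) / 2 with hβdef
  have hβ : 0 < β := by linarith
  have hβT : T < β := by linarith
  have hβα : β < αLow := by linarith
  have hlow : M.shapeFactor * (1 / 4) * (1 - D.θ) ^ 2 * a * C ^ 2 ≤ T * c := by
    have h1 : a * c ^ 2 ≤ a ^ 3 := by nlinarith [mul_self_le_mul_self hc.le hca]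
    have h2 : T * c = M.shapeFactor * (1 / 4) * (1 - D.θ) ^ 2 * C ^ 2 * (a ^ 3 / c ^ 2) := by
      rw [hTdef]
      field_simp
    have h3 : a ≤ a ^ 3 / c ^ 2 := by rwa [le_div_iff₀ (by positivity)]
    rw [h2]
    calc _ = M.shapeFactor * (1 / 4) * (1 - D.θ) ^ 2 * C ^ 2 * a := by ring
      _ ≤ _ := by gcongr
  refine ⟨c - (1 - D.θ) ^ 2 * a / (8 * β) * (2 * M.shapeFactor * C ^ 2), (αLow - β) * c, ?_,
    mul_pos (by linarith) hc, fun w hw => ?_⟩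
  · have h1 : (1 - D.θ) ^ 2 * a / (8 * β) * (2 * M.shapeFactor * C ^ 2) =
        M.shapeFactor * (1 / 4) * (1 - D.θ) ^ 2 * a * C ^ 2 / β := by
      field_simp
      ring
    rw [h1, sub_pos, div_lt_iff₀ hβ]
    nlinarith
  have hvol : c * ∑ K, ∫ x in M.elem K, ‖gradient (w K) x‖ ^ 2 ≤
      ∑ K, ∫ x in M.elem K, D.coef D.lamT K x * inner ℝ (brokenGrad w K x) (brokenGrad w K x) := by
    rw [Finset.mul_sum]
    refine Finset.sum_le_sum fun K _ => ?_
    have hg : Continuous (gradient (w K)) := continuous_brokenGrad hw K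
    have hcf := (hT K).1
    rw [← integral_const_mul]
    refine integral_mono (integrableOn_elem M K (by fun_prop))
      (integrableOn_elem M K (hcf.mul (hg.inner hg))) fun x => ?_
    simp only [brokenGrad, real_inner_self_eq_norm_sq]
    gcongr
    exact (hac K x).1
  have hfaces := Finset.sum_le_sum fun e (he : e ∈ M.faces) =>
    integral_face_terms_ge hT hc hac hw he
      (IsFacet.diam_pos (by omega) (M.isCell _).isCompact (M.isFacet_fst he)) (hα e he) hβ hβα
  rw [Finset.sum_sub_distrib, Finset.sum_sub_distrib, ← Finset.mul_sum, ← Finset.mul_sum] at hfaces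
  simp_rw [mul_assoc ((αLow - β) * c)] at hfaces
  rw [← Finset.mul_sum] at hfaces
  have htr := mul_le_mul_of_nonneg_left (M.sum_integral_faces_le hd hC hw)
    (by positivity : 0 ≤ (1 - D.θ) ^ 2 * a / (8 * β))
  rw [b]
  linarith

/-- Functions without gradient and jumps are constant; if they also vanish on a boundary face,
they are zero. -/
theorem eq_zero_of_gradient_of_jump (hd : 2 ≤ d) (hΩ : IsConnected M.domain)
    {w : ι → E d → ℝ} (hw : w ∈ M.X)
    (hgrad : ∑ K, ∫ x in M.elem K, ‖gradient (w K) x‖ ^ 2 = 0)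
    (hjump : ∑ e ∈ M.faces, (M.faceSize e)⁻¹ *
      ∫ x in M.face e, M.jump w e x ^ 2 ∂μHE[d - 1] = 0)
    {K₀ : ι} {F₀ : Set (E d)} (hF₀ : IsFacet (M.elem K₀) F₀)
    (hbd : w K₀ =ᵐ[μHE[d - 1].restrict F₀] 0) : w = 0 := by
  have hconst : ∀ K, ∃ c : ℝ, w K = fun _ => c := by
    intro K
    have hg : Continuous (gradient (w K)) := continuous_brokenGrad hw K
    have h1 := (Finset.sum_eq_zero_iff_of_nonneg fun K _ =>
      integral_nonneg fun x => sq_nonneg _).1 hgrad K (Finset.mem_univ K)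
    rw [integral_eq_zero_iff_of_nonneg (fun x => sq_nonneg _)
      (integrableOn_elem M K (hg.norm.pow 2))] at h1
    refine exists_eq_const_of_gradient_ae_eq_zero (M.isCell K).interior_nonempty
      (M.mem_localSpace hw K) ?_
    filter_upwards [h1] with x hx
    simpa using hx
  choose c hc using hconst
  have hsize : ∀ e ∈ M.faces, 0 < M.faceSize e := fun e he =>
    IsFacet.diam_pos hd (M.isCell _).isCompact (M.isFacet_fst he)
  have hnull : ∀ {K : ι} {F : Set (E d)} {r : ℝ}, IsFacet (M.elem K) F →
      (∀ᵐ _ ∂(μHE[d - 1] : Measure (E d)).restrict F, r = 0) → r = 0 := by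
    intro K F r hF h
    have h1 := hF.measure_pos (M.isCell K).convex
    have h2 : NeZero ((μHE[d - 1] : Measure (E d)).restrict F) :=
      ⟨by rw [Ne, Measure.restrict_eq_zero]; exact h1.ne'⟩
    exact h.exists.choose_spec
  have hface : ∀ e ∈ M.faces, c e.1 = c e.2 := by
    intro e he
    have h1 := (Finset.sum_eq_zero_iff_of_nonneg fun e he =>
      mul_nonneg (inv_nonneg.2 (hsize e he).le) (integral_nonneg fun x => sq_nonneg _)).1 hjump e he
    rw [mul_eq_zero, or_iff_right (inv_ne_zero (hsize e he).ne'),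
      integral_eq_zero_iff_of_nonneg (fun x => sq_nonneg _)
        (integrableOn_face M he ((continuous_jump hw e).pow 2))] at h1
    refine sub_eq_zero.1 (hnull (M.isFacet_fst he) ?_)
    filter_upwards [h1] with x hx
    simpa [DGMesh.jump, hc] using hx
  have h₀ : c K₀ = 0 := by
    refine hnull hF₀ ?_
    filter_upwards [hbd] with x hx
    simpa [hc] using hx
  have hall := M.forall_of_forall_faces_iff hΩ (p := fun K => c K = 0)
    (fun e he => by rw [hface e he]) h₀
  ext K x
  rw [hc K, hall K]
  rfl

end PressureData

instance DGMesh.finiteDimensional_X {d : ℕ} {ι : Type*} [Fintype ι] (M : DGMesh d ι) :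
    FiniteDimensional ℝ M.X := by
  let g : M.X →ₗ[ℝ] ι → localSpace d M.cell :=
    { toFun := fun w K => ⟨w.1 K, w.2 K (mem_univ K)⟩
      map_add' := fun _ _ => rfl
      map_smul' := fun _ _ => rfl }
  refine FiniteDimensional.of_injective g fun u v h => ?_
  ext K x
  exact congrFun (congrArg Subtype.val (congrFun h K)) x

/-- The functions of the discrete space that vanish on the Dirichlet boundary. -/
def DGMesh.XD {d : ℕ} {ι : Type*} [Fintype ι] (M : DGMesh d ι) (ΓD : Finset (ι × Set (E d))) :
    Submodule ℝ (ι → E d → ℝ) where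
  carrier := {w | w ∈ M.X ∧ M.TraceEq ΓD w 0}
  zero_mem' := ⟨M.X.zero_mem, fun _ _ => Filter.EventuallyEq.rfl⟩
  add_mem' := by
    rintro u v ⟨hu, hu'⟩ ⟨hv, hv'⟩
    refine ⟨M.X.add_mem hu hv, fun p hp => ?_⟩
    filter_upwards [hu' p hp, hv' p hp] with x h1 h2
    simp [h1, h2]
  smul_mem' := by
    rintro c u ⟨hu, hu'⟩
    refine ⟨M.X.smul_mem c hu, fun p hp => ?_⟩
    filter_upwards [hu' p hp] with x h1
    simp [h1]

theorem DGMesh.XD_le {d : ℕ} {ι : Type*} [Fintype ι] (M : DGMesh d ι)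
    (ΓD : Finset (ι × Set (E d))) : M.XD ΓD ≤ M.X := fun _ h => h.1

theorem mainTheorem3 {d : ℕ} (hd : d = 2 ∨ d = 3) {ι : Type*} [Fintype ι]
    (M : DGMesh d ι) (hΩ : IsConnected M.domain)
    (ΓD ΓN : Finset (ι × Set (E d)))
    (hΓ : (ΓD : Set (ι × Set (E d))) ∪ ΓN = M.bdryFaces) (hΓD : ΓD.Nonempty)
    (D : PressureData d ι)
    -- the discrete solution at the old time
    (hP : D.P ∈ M.X) (hSv : D.Sv ∈ M.X) (hSa : D.Sa ∈ M.X)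
    -- continuity of the mobilities, and their bounds
    (hLc : Continuous fun z : ℝ × ℝ × ℝ => D.lamL z.1 z.2.1 z.2.2)
    (hVc : Continuous fun z : ℝ × ℝ × ℝ => D.lamV z.1 z.2.1 z.2.2)
    (hAc : Continuous fun z : ℝ × ℝ × ℝ => D.lamA z.1 z.2.1 z.2.2)
    (hL : ∀ p sv sa, 0 < D.lamL p sv sa) (hV : ∀ p sv sa, 0 < D.lamV p sv sa)
    (hA : ∀ p sv sa, 0 < D.lamA p sv sa)
    (lamLow lamUp : ℝ) (hlam : 0 < lamLow)
    (hT : ∀ p sv sa, lamLow ≤ D.lamT p sv sa ∧ D.lamT p sv sa ≤ lamUp)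
    (κLow κUp : ℝ) (hκ0 : 0 < κLow) (hκ : ∀ K, κLow ≤ D.κ K ∧ D.κ K ≤ κUp)
    (hρL : 0 < D.rhoL) (hρV : 0 < D.rhoV) (hρA : 0 < D.rhoA)
    -- capillary pressures, sources, boundary data
    (hpcv : ContDiff ℝ 1 D.pcv) (hpca : ContDiff ℝ 1 D.pca)
    (hqL : MemLp D.qL ⊤ (volume.restrict M.domain))
    (hqV : MemLp D.qV ⊤ (volume.restrict M.domain))
    (hqA : MemLp D.qA ⊤ (volume.restrict M.domain))
    (hjN : ∀ p ∈ ΓN, IntegrableOn D.jN p.2 μHE[d - 1])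
    (hbdy : ∃ v ∈ M.X, M.TraceEq ΓD v D.pbdy)
    (hθ : D.θ = -1 ∨ D.θ = 0 ∨ D.θ = 1) :
    (∃ Ctr : ℝ, 0 < Ctr ∧ M.IsTraceConstant Ctr) ∧
    ∀ Ctr : ℝ, 0 < Ctr → M.IsTraceConstant Ctr →
      ∀ αLow : ℝ, (∀ e ∈ M.faces, αLow ≤ D.α e) →
        M.shapeFactor * (1 / 4) * (1 - D.θ) ^ 2 * (lamUp * κUp) ^ 3 / (lamLow * κLow) ^ 3
          * Ctr ^ 2 < αLow →
        ∃! u : ι → E d → ℝ, D.IsDiscreteSolution M ΓD ΓN u := by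
  have hd0 : d ≠ 0 := by omega
  have hd2 : 2 ≤ d := by omega
  refine ⟨M.exists_isTraceConstant hd0, ?_⟩
  intro Ctr _ hC αLow hα hthr
  have hκpos : ∀ K, 0 < D.κ K := fun K => hκ0.trans_le (hκ K).1
  have hVadm := PressureData.isAdmissible hP hSv hSa hκpos hVc hV
  have hAadm := PressureData.isAdmissible hP hSv hSa hκpos hAc hA
  have hTadm : D.IsAdmissible D.lamT := PressureData.isAdmissible hP hSv hSa hκpos
    ((hLc.add hVc).add hAc) fun p sv sa => hlam.trans_le (hT p sv sa).1
  have hρadm : D.IsAdmissible D.rhoLamT := PressureData.isAdmissible hP hSv hSa hκpos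
    (((continuous_const.mul hLc).add (continuous_const.mul hVc)).add (continuous_const.mul hAc))
    fun p sv sa => by
      have := hL p sv sa
      have := hV p sv sa
      have := hA p sv sa
      rw [PressureData.rhoLamT]
      positivity
  obtain ⟨⟨K₀, F₀⟩, h₀⟩ := hΓD
  have hbdry : ∀ p, p ∈ ΓD ∨ p ∈ ΓN → IsFacet (M.elem p.1) p.2 := by
    intro p hp
    have : p ∈ M.bdryFaces := by
      rw [← hΓ]
      exact hp
    exact this.1
  have hF₀ : IsFacet (M.elem K₀) F₀ := hbdry _ (Or.inl h₀)
  have hκUp : 0 < κUp := (hκpos K₀).trans_le (hκ K₀).2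
  have hlamUp : lamLow ≤ lamUp := (hT 0 0 0).1.trans (hT 0 0 0).2
  have hc : 0 < lamLow * κLow := mul_pos hlam hκ0
  have hac : ∀ K x, D.coef D.lamT K x ∈ Icc (lamLow * κLow) (lamUp * κUp) := by
    intro K x
    obtain ⟨h1, h2⟩ := hκ K
    obtain ⟨h3, h4⟩ := hT (D.P K x) (D.Sv K x) (D.Sa K x)
    rw [PressureData.coef, mul_comm (D.κ K)]
    exact ⟨mul_le_mul h3 h1 hκ0.le (hlam.le.trans h3),
      mul_le_mul h4 h2 (hκpos K).le (hlam.le.trans hlamUp)⟩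
  obtain ⟨δ, ε, hδ, hε, hcoer⟩ := PressureData.exists_coercivity hd hTadm hc hac
    ((hac K₀ 0).1.trans (hac K₀ 0).2) hC hα hthr
  have hdef : ∀ w ∈ M.XD ΓD, D.b M w w = 0 → w = 0 := by
    rintro w ⟨hw, hw0⟩ hb
    have h1 := hcoer w hw
    rw [hb] at h1
    have h2 : 0 ≤ ∑ K, ∫ x in M.elem K, ‖gradient (w K) x‖ ^ 2 :=
      Finset.sum_nonneg fun K _ => integral_nonneg fun x => sq_nonneg _
    have h3 : 0 ≤ ∑ e ∈ M.faces, (M.faceSize e)⁻¹ *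
        ∫ x in M.face e, M.jump w e x ^ 2 ∂μHE[d - 1] :=
      Finset.sum_nonneg fun e _ => mul_nonneg (inv_nonneg.2 Metric.diam_nonneg)
        (integral_nonneg fun x => sq_nonneg _)
    have h4 := mul_nonneg hδ.le h2
    have h5 := mul_nonneg hε.le h3
    have h6 := (mul_eq_zero.1 (le_antisymm (by linarith) h4)).resolve_left hδ.ne'
    have h7 := (mul_eq_zero.1 (le_antisymm (by linarith) h5)).resolve_left hε.ne'
    exact PressureData.eq_zero_of_gradient_of_jump hd2 hΩ hw h6 h7 hF₀ (hw0 _ h₀)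
  have hbr : ∀ u ∈ M.X, IsLinearOn M.X (D.b M u) := fun u hu =>
    PressureData.isLinearOn_b_right hTadm hu
  have hbl : ∀ w ∈ M.X, IsLinearOn M.X fun u => D.b M u w := fun w hw =>
    PressureData.isLinearOn_b_left hTadm hw
  have hf : IsLinearOn M.X (D.f M ΓN) :=
    PressureData.isLinearOn_f hVadm hAadm hρadm hSv hSa hpcv hpca hqL hqV hqA
      (fun p hp => (hbdry p (Or.inr hp)).isCompact (M.isCell _).isCompact) hjN
  have hle := M.XD_le ΓD
  have : FiniteDimensional ℝ (M.XD ΓD) := Submodule.finiteDimensional_of_le hle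
  -- lift the Dirichlet data and solve for the remainder
  obtain ⟨g, hg, hgD⟩ := hbdy
  obtain ⟨u, ⟨hu, hub⟩, huniq⟩ := existsUnique_of_definite (V := M.XD ΓD) (b := D.b M)
    (f := fun w => D.f M ΓN w - D.b M g w) (fun w hw => (hbl w (hle hw)).mono hle)
    (fun u hu => (hbr u (hle hu)).mono hle) ((hf.sub (hbr g hg)).mono hle) hdef
  refine ⟨g + u, ⟨M.X.add_mem hg hu.1, fun p hp => ?_, fun w hw hw0 => ?_⟩, ?_⟩
  · filter_upwards [hgD p hp, hu.2 p hp] with x h1 h2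
    simp [h1, h2]
  · have h1 : D.b M (g + u) w = D.b M g w + D.b M u w := (hbl w hw).map_add hg hu.1
    have h2 := hub w ⟨hw, hw0⟩
    linarith
  · rintro v ⟨hv, hvD, hvb⟩
    have hsub : v - g ∈ M.XD ΓD := by
      refine ⟨M.X.sub_mem hv hg, fun p hp => ?_⟩
      filter_upwards [hgD p hp, hvD p hp] with x h1 h2
      simp [h1, h2]
    have : v - g = u := by
      refine huniq _ ⟨hsub, fun w hw => ?_⟩
      have h1 := (hbl w hw.1).map_add hsub.1 hg
      have h2 := hvb w hw.1 hw.2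
      rw [sub_add_cancel] at h1
      linarith
    rw [← this, add_sub_cancel]
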